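/- For a nonnegative integer $n$, let $c_5(n)$ denote the number of $5$-cores of $n$, that is, the number of partitions of $n$ none of whose hook numbers is divisible by $5$. Let $\varphi(-q)=\sum_{k=-\infty}^{\infty}(-1)^k q^{k^2}$, and define $\overline{a}_5(n)$ by $$\sum_{n=0}^{\infty}\overline{a}_5(n)q^n=\frac{\varphi^5(-q^5)}{\varphi(-q)}.$$ Then, for every nonnegative integer $n$, \begin{align*} \overline{a}_5(5n+2)&=4c_5(5n+1), & \overline{a}_5(5n+3)&=4c_5(5n+2),\\ \overline{a}_5(10n+1)&=2c_5(10n), & \overline{a}_5(10n+9)&=2c_5(10n+8),\\ \overline{a}_5(20n+6)&=10c_5(10n+2), & \overline{a}_5(20n+14)&=10c_5(10n+6). \end{align*} Furthermore, for every nonnegative integer $n$ and every integer $k\ge 2$, $$\overline{a}_5(5^k n)=\left(\frac{5^k-1}{4}\right)\overline{a}_5(5n)-\left(\frac{5^k-5}{4}\right)\overline{a}_5(n).$$ (For $k=2$ this reads $\overline{a}_5(25n)=6\,\overline{a}_5(5n)-5\,\overline{a}_5(n)$.) -/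

import Mathlib

namespace CorePartitions

/-- The hook number of the node `(i, j)` (row `i`, column `j`, both counted from `0`) of the
Ferrers--Young diagram `μ`: the number of nodes directly to the right of or directly below the
node, the node itself included. In `1`-based coordinates `(i + 1, j + 1)` this is
`λ_{i+1} + λ'_{j+1} - (i + 1) - (j + 1) + 1`; the subtraction does not truncate when
`(i, j) ∈ μ`. -/
def hookNumber (μ : YoungDiagram) (i j : ℕ) : ℕ :=
  μ.rowLen i + μ.colLen j - (i + j + 1)

/-- A partition (given by its Ferrers--Young diagram) is a `t`-core if none of its hook numbers
is divisible by `t`. -/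
def IsCore (t : ℕ) (μ : YoungDiagram) : Prop :=
  ∀ i j : ℕ, (i, j) ∈ μ → ¬ t ∣ hookNumber μ i j

/-- `c t n` is the number of partitions of `n` that are `t`-cores. -/
noncomputable def c (t n : ℕ) : ℕ :=
  Set.ncard {μ : YoungDiagram | μ.card = n ∧ IsCore t μ}

/-- The set counted by `c t n` is finite. -/
theorem finite_cores (t n : ℕ) : {μ : YoungDiagram | μ.card = n ∧ IsCore t μ}.Finite := by
  have hinj : Function.Injective YoungDiagram.cells := fun μ ν h => YoungDiagram.ext h
  refine Set.Finite.subset (Set.Finite.preimage hinj.injOn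
    (Finset.finite_toSet (Finset.range n ×ˢ Finset.range n).powerset)) ?_
  rintro μ ⟨hμ, -⟩
  simp only [Set.mem_preimage, Finset.mem_coe, Finset.mem_powerset]
  rintro ⟨i, j⟩ hij
  have hij' : (i, j) ∈ μ := hij
  have h1 : j < μ.rowLen i := YoungDiagram.mem_iff_lt_rowLen.1 hij'
  have h2 : i < μ.colLen j := YoungDiagram.mem_iff_lt_colLen.1 hij'
  have h3 : μ.rowLen i ≤ μ.card := by
    rw [YoungDiagram.rowLen_eq_card]
    exact Finset.card_le_card (Finset.filter_subset _ _)
  have h4 : μ.colLen j ≤ μ.card := by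
    rw [YoungDiagram.colLen_eq_card]
    exact Finset.card_le_card (Finset.filter_subset _ _)
  simp only [Finset.mem_product, Finset.mem_range]
  omega

/-- Ramanujan's theta function `φ(-q) = ∑_{k ∈ ℤ} (-1)^k q^{k^2}` as a formal power series in `q`:
the coefficient of `q^n` is the sum of `(-1)^k` over all integers `k` with `k^2 = n` (all of which
lie between `-n` and `n`). -/
noncomputable def phiNeg : PowerSeries ℤ :=
  PowerSeries.mk fun n : ℕ =>
    ∑ k ∈ (Finset.Icc (-(n : ℤ)) (n : ℤ)).filter (fun k => k ^ 2 = (n : ℤ)), (-1 : ℤ) ^ k.natAbs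

/-- The constant term of `φ(-q)` is `1`, so that `φ(-q)` is invertible. -/
theorem constantCoeff_phiNeg : PowerSeries.constantCoeff phiNeg = ((1 : ℤˣ) : ℤ) := by
  rw [← PowerSeries.coeff_zero_eq_constantCoeff_apply, phiNeg, PowerSeries.coeff_mk]
  decide

/-- `abar t n` is the coefficient of `q^n` in `φ(-q^t)^t / φ(-q)`. -/
noncomputable def abar (t : ℕ) [NeZero t] (n : ℕ) : ℤ :=
  PowerSeries.coeff n
    (PowerSeries.expand t (NeZero.ne t) phiNeg ^ t * PowerSeries.invOfUnit phiNeg 1)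

end CorePartitions

/-!
Write `E_k = ∏_{n ≥ 1} (1 - q ^ (k n))`, `φ = φ(-q)`, and let `σ(n) = ∑_{d ∣ n} χ₅(d) d` be the
divisor sum twisted by the quadratic character modulo `5`. The proof has three ingredients.

* **Cores.** A partition is determined by its set of beta-numbers, and it is a `5`-core if and only
  if this set is stable under `x ↦ x - 5` (`isCore_iff_isClosedUnderSub`). Such a set is described
  by its numbers of beads on the five runners of an abacus, so `5`-cores of `n` correspond to the
  integer vectors with sum `0` on which a certain quadratic form takes the value `n`
  (`c_five_eq_ncard`). The `q`-binomial theorem, applied to `∏ (1 + t q ^ i)` as a whole and to its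
  five parts with `i` in a fixed class modulo `5`, evaluates the generating function of these
  vectors in the limit. This gives the theorem of Garvan, Kim and Stanton
  `∑ c₅(n) q ^ n = E₅⁵ / E₁` (`coreSeries_mul_euler`).

* **The Lambert series.** Ramanujan's identity `E₁⁵ / E₅ = 1 - 5 ∑ σ(n) q ^ n` (`euler_pow_five`)
  follows by computing the Wronskian of `f(-q, -q⁴)` and `f(-q², -q³)` in two ways: from their
  triple products, and as a theta series of `x² + y²` with weight of degree two, which is `E₁⁶` by
  Jacobi's formula for `E₁³`. The five-dissection `E₁ = s + u + t` with `s t = -u²` then shows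
  (`resPart_X_mul_core`) that `A(n) = c₅(n - 1)` satisfies `A(5 n) = 5 A(n)`, that `A(n) = σ(n)` for
  `n ≡ ±1 (mod 5)`, and that `A(n) = -σ(n)` for `n ≡ ±2 (mod 5)`.

* **The quotient of theta functions.** The identities
  `φ(-q⁵)² - φ(-q)² = 4 q f(-q, -q⁹) f(-q³, -q⁷)` and `ψ(q)² - q ψ(q⁵)² = f(q, q⁴) f(q², q³)`
  (`phiNeg_sq_sub`, `psi_sq_sub`) are identities between theta series of `x² + y²` whose weights
  depend on `x` and `y` modulo `10` or `20`. They express the products `1 - 4 y` and `1 + y` with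
  `y = q E₁ E₁₀⁵ / (E₂ E₅⁵)` as eta quotients. In units of `F = φ(-q⁵)⁵ / φ(-q)` the series
  `L = E₁⁵ / E₅` and `q C = q E₅⁵ / E₁` and their values at `q²` are polynomials in `y`, and
  comparing these polynomials gives (`five_mul_abarSeries`)
  `5 F = L(q) + 4 L(q²) + 15 q C(q) + 20 q² C(q²)`.

Comparing coefficients, and using `σ(2 n) = -σ(n)` for odd `n`, one obtains the six identities on
arithmetic progressions. Since `σ(5 n) = σ(n)` while `A(5 n) = 5 A(n)`, the sequence
`k ↦ 5 * abar 5 (5 ^ k * n)` has the form `x + 5 ^ k y`, which is the last claim.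
-/

namespace CorePartitions

open PowerSeries PowerSeries.WithPiTopology Filter Topology

/-! ### Convergence of formal power series -/

theorem tendsto_iff_eventually_coeff {ι : Type*} {l : Filter ι} {f : ι → ℤ⟦X⟧} {g : ℤ⟦X⟧} :
    Tendsto f l (𝓝 g) ↔ ∀ d, ∀ᶠ i in l, coeff d (f i) = coeff d g := by
  rw [tendsto_iff_coeff_tendsto]
  simp [nhds_discrete]

theorem coeff_mul_congr {f g h : ℤ⟦X⟧} {d : ℕ} (H : ∀ i ≤ d, coeff i f = coeff i g) :
    coeff d (h * f) = coeff d (h * g) := by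
  rw [coeff_mul, coeff_mul]
  refine Finset.sum_congr rfl fun p hp => ?_
  have hp' := Finset.HasAntidiagonal.mem_antidiagonal.1 hp
  rw [H p.2 (by omega)]

theorem hasSum_monomial {ι : Type*} {e : ι → ℕ} (a : ι → ℤ) {s : ℕ → Finset ι}
    (hs : ∀ n i, e i = n → i ∈ s n) :
    HasSum (fun i => monomial (e i) (a i))
      (PowerSeries.mk fun n => ∑ i ∈ (s n).filter (e · = n), a i) := by
  rw [hasSum_iff_hasSum_coeff]
  intro n
  rw [coeff_mk]
  have : ∑ i ∈ (s n).filter (e · = n), a i =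
      ∑ i ∈ (s n).filter (e · = n), coeff n (monomial (e i) (a i)) := by
    refine Finset.sum_congr rfl fun i hi => ?_
    simp [(Finset.mem_filter.1 hi).2]
  rw [this]
  refine hasSum_sum_of_ne_finset_zero fun i hi => ?_
  rw [coeff_monomial, if_neg]
  rintro rfl
  exact hi (by simpa using hs _ i rfl)

theorem summable_monomial {ι : Type*} {e : ι → ℕ} (a : ι → ℤ)
    (he : ∀ n, {i | e i = n}.Finite) : Summable fun i => monomial (e i) (a i) :=
  (hasSum_monomial (s := fun n => (he n).toFinset) a (by simp)).summable

theorem HasSum.monomial_mul {ι κ : Type*} {e : ι → ℕ} {a : ι → ℤ} {e' : κ → ℕ} {a' : κ → ℤ}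
    {f g : ℤ⟦X⟧} (hf : HasSum (fun i => monomial (e i) (a i)) f)
    (hg : HasSum (fun i => monomial (e' i) (a' i)) g)
    (he : ∀ n, {i | e i ≤ n}.Finite) (he' : ∀ n, {i | e' i ≤ n}.Finite) :
    HasSum (fun p : ι × κ => monomial (e p.1 + e' p.2) (a p.1 * a' p.2)) (f * g) := by
  have h := HasSum.mul (f := fun i => (monomial (e i) (a i) : ℤ⟦X⟧))
    (g := fun i => (monomial (e' i) (a' i) : ℤ⟦X⟧)) hf hg ?_
  · simpa only [monomial_mul_monomial] using h
  · simp only [monomial_mul_monomial]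
    refine summable_monomial (e := fun p : ι × κ => e p.1 + e' p.2) _ fun n =>
      (((he n).prod (he' n)).subset ?_)
    rintro ⟨i, j⟩ h
    simp only [Set.mem_ofPred_eq, Set.mem_prod] at h ⊢
    omega

/-- Termwise passage to the limit in a sum of power series whose `i`-th term is divisible by
`X ^ e i`: this needs no domination hypothesis, since only finitely many terms contribute to a
given coefficient. -/
theorem tendsto_sum_monomial_mul {ι : Type*} {e : ι → ℕ} {a : ι → ℤ} {f L : ℤ⟦X⟧}
    (he : ∀ n, {i | e i ≤ n}.Finite) (hf : HasSum (fun i => monomial (e i) (a i)) f)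
    {S : ℕ → Finset ι} (hS : ∀ i, ∀ᶠ M in atTop, i ∈ S M) {A : ℕ → ι → ℤ⟦X⟧}
    (hA : ∀ i, Tendsto (fun M => A M i) atTop (𝓝 L)) :
    Tendsto (fun M => ∑ i ∈ S M, monomial (e i) (a i) * A M i) atTop (𝓝 (f * L)) := by
  rw [tendsto_iff_eventually_coeff]
  intro d
  have h1 : ∀ᶠ M in atTop, ∀ i ∈ (he d).toFinset, i ∈ S M ∧ ∀ j ∈ Finset.range (d + 1),
      coeff j (A M i) = coeff j L := by
    rw [Filter.eventually_all_finset]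
    intro i _
    refine (hS i).and ?_
    rw [Filter.eventually_all_finset]
    intro j _
    exact tendsto_iff_eventually_coeff.1 (hA i) j
  have h0 : ∀ i ∉ (he d).toFinset, ∀ g : ℤ⟦X⟧, coeff d (monomial (e i) (a i) * g) = 0 := by
    intro i hi g
    have : d < e i := by simpa using hi
    rw [coeff_mul]
    refine Finset.sum_eq_zero fun p hp => ?_
    have := Finset.HasAntidiagonal.mem_antidiagonal.1 hp
    rw [coeff_monomial, if_neg (by omega), zero_mul]
  have h2 : coeff d (f * L) =
      ∑ i ∈ (he d).toFinset, coeff d (monomial (e i) (a i) * L) := by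
    have h3 := (hasSum_iff_hasSum_coeff ℤ).1 (hf.mul_right L) d
    exact h3.unique (hasSum_sum_of_ne_finset_zero fun i hi => h0 i hi L)
  filter_upwards [h1] with M hM
  rw [h2, map_sum, ← Finset.sum_subset (fun i hi => (hM i hi).1) fun i _ hi => h0 i hi _]
  refine Finset.sum_congr rfl fun i hi => coeff_mul_congr fun j hj => ?_
  exact (hM i hi).2 j (by simpa using Nat.lt_succ_of_le hj)

theorem continuous_expand {k : ℕ} (hk : k ≠ 0) :
    Continuous (expand k hk : ℤ⟦X⟧ → ℤ⟦X⟧) := by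
  rw [continuous_iff_continuousAt]
  intro f
  refine tendsto_iff_eventually_coeff.2 fun d => ?_
  have h := tendsto_iff_eventually_coeff.1 (tendsto_id (x := 𝓝 f)) (d / k)
  filter_upwards [h] with g hg
  rw [coeff_expand, coeff_expand]
  split_ifs
  · exact hg
  · rfl

theorem expand_injective {k : ℕ} (hk : k ≠ 0) :
    Function.Injective (expand k hk : ℤ⟦X⟧ → ℤ⟦X⟧) := by
  intro f g h
  ext n
  rw [← coeff_expand_mul k hk f, ← coeff_expand_mul k hk g]
  exact congrArg (coeff (k * n)) h

theorem HasSum.expand_monomial {ι : Type*} {e : ι → ℕ} {a : ι → ℤ} {f : ℤ⟦X⟧}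
    (hf : HasSum (fun i => monomial (e i) (a i)) f) {k : ℕ} (hk : k ≠ 0) :
    HasSum (fun i => monomial (k * e i) (a i)) (expand k hk f) := by
  have := hf.map (expand k hk) (continuous_expand hk)
  simpa [Function.comp_def] using this

theorem HasSum.X_pow_mul_monomial {ι : Type*} {e : ι → ℕ} {a : ι → ℤ} {f : ℤ⟦X⟧}
    (hf : HasSum (fun i => monomial (e i) (a i)) f) (k : ℕ) :
    HasSum (fun i => monomial (k + e i) (a i)) ((X : ℤ⟦X⟧) ^ k * f) := by
  have := hf.mul_left ((X : ℤ⟦X⟧) ^ k)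
  simpa [X_pow_eq, monomial_mul_monomial] using this

/-- The Euler operator `q d/dq` on power series. -/
noncomputable def eulerD (f : ℤ⟦X⟧) : ℤ⟦X⟧ := PowerSeries.mk fun n => (n : ℤ) * coeff n f

@[simp] theorem coeff_eulerD (f : ℤ⟦X⟧) (n : ℕ) : coeff n (eulerD f) = n * coeff n f := by
  simp [eulerD]

theorem eulerD_mul (f g : ℤ⟦X⟧) : eulerD (f * g) = eulerD f * g + f * eulerD g := by
  ext n
  rw [map_add, coeff_eulerD, coeff_mul, coeff_mul, coeff_mul, Finset.mul_sum,
    ← Finset.sum_add_distrib]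
  refine Finset.sum_congr rfl fun p hp => ?_
  rw [coeff_eulerD, coeff_eulerD, ← Finset.HasAntidiagonal.mem_antidiagonal.1 hp]
  push_cast
  ring

theorem eulerD_expand {k : ℕ} (hk : k ≠ 0) (f : ℤ⟦X⟧) :
    eulerD (expand k hk f) = k * expand k hk (eulerD f) := by
  ext n
  rw [coeff_eulerD, ← map_natCast (C (R := ℤ)), coeff_C_mul, coeff_expand, coeff_expand]
  split_ifs with h
  · obtain ⟨m, rfl⟩ := h
    rw [Nat.mul_div_cancel_left _ (Nat.pos_of_ne_zero hk), coeff_eulerD]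
    push_cast
    ring
  · simp

theorem eulerD_X_pow (k : ℕ) : eulerD ((X : ℤ⟦X⟧) ^ k) = (k : ℤ⟦X⟧) * (X : ℤ⟦X⟧) ^ k := by
  ext n
  rw [coeff_eulerD, ← map_natCast (C (R := ℤ)), coeff_C_mul, coeff_X_pow]
  split_ifs with h
  · simp [h]
  · simp

theorem tendsto_eulerD {ι : Type*} {l : Filter ι} {f : ι → ℤ⟦X⟧} {g : ℤ⟦X⟧}
    (h : Tendsto f l (𝓝 g)) : Tendsto (fun i => eulerD (f i)) l (𝓝 (eulerD g)) := by
  rw [tendsto_iff_eventually_coeff] at h ⊢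
  intro d
  filter_upwards [h d] with i hi
  simp [hi]

theorem HasSum.eulerD_monomial {ι : Type*} {e : ι → ℕ} {a : ι → ℤ} {f : ℤ⟦X⟧}
    (hf : HasSum (fun i => monomial (e i) (a i)) f) :
    HasSum (fun i => monomial (e i) (e i * a i)) (eulerD f) := by
  rw [hasSum_iff_hasSum_coeff] at hf ⊢
  intro d
  have := (hf d).mul_left (d : ℤ)
  rw [coeff_eulerD]
  refine Eq.mpr (congrArg (HasSum · _) (funext fun i => ?_)) this
  rw [coeff_monomial, coeff_monomial]
  split_ifs with h
  · rw [h]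
  · simp

/-! ### Gaussian binomial coefficients -/

section Gauss
variable {R : Type*} [CommRing R]

/-- The `q`-factorial product `(1 - q)(1 - q²)⋯(1 - q ^ n)`. -/
def qPoch (q : R) (n : ℕ) : R := ∏ i ∈ Finset.range n, (1 - q ^ (i + 1))

/-- The Gaussian binomial coefficient, defined by a `q`-Pascal recursion. -/
def gauss (q : R) : ℕ → ℕ → R
  | _, 0 => 1
  | 0, _ + 1 => 0
  | n + 1, k + 1 => gauss q n (k + 1) + q ^ (n - k) * gauss q n k

theorem gauss_zero_right (q : R) (n : ℕ) : gauss q n 0 = 1 := by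
  cases n <;> rfl

theorem gauss_eq_zero (q : R) : ∀ {n k : ℕ}, n < k → gauss q n k = 0
  | 0, _ + 1, _ => rfl
  | n + 1, k + 1, h => by
    rw [gauss, gauss_eq_zero q (by omega : n < k + 1), gauss_eq_zero q (by omega : n < k)]
    ring

theorem qPoch_succ (q : R) (n : ℕ) : qPoch q (n + 1) = qPoch q n * (1 - q ^ (n + 1)) :=
  Finset.prod_range_succ _ _

theorem qPoch_zero (q : R) : qPoch q 0 = 1 := Finset.prod_range_zero _

theorem gauss_self (q : R) (n : ℕ) : gauss q n n = 1 := by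
  induction n with
  | zero => rfl
  | succ n ih => rw [gauss, gauss_eq_zero q (Nat.lt_succ_self n), ih]; simp

theorem gauss_mul_qPoch (q : R) (k l : ℕ) :
    gauss q (k + l) k * qPoch q k * qPoch q l = qPoch q (k + l) := by
  induction k generalizing l with
  | zero => simp [gauss_zero_right, qPoch_zero]
  | succ k ihk =>
    induction l with
    | zero => simp [gauss_self, qPoch_zero]
    | succ l ihl =>
      have h1 := ihk (l + 1)
      have e : k + 1 + (l + 1) = (k + 1 + l) + 1 := by ring
      have e' : k + (l + 1) = k + 1 + l := by ring
      rw [e'] at h1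
      have hg : gauss q (k + 1 + l + 1) (k + 1) =
          gauss q (k + 1 + l) (k + 1) + q ^ (l + 1) * gauss q (k + 1 + l) k := by
        rw [gauss]; congr 3; omega
      rw [e, hg, qPoch_succ q (k + 1 + l)]
      rw [qPoch_succ q k] at ihl ⊢
      rw [qPoch_succ q l] at h1 ⊢
      linear_combination (1 - q ^ (l + 1)) * ihl + q ^ (l + 1) * (1 - q ^ (k + 1)) * h1

/-- The `q`-binomial theorem. -/
theorem prod_add_mul_pow (q w t : R) (n : ℕ) :
    ∏ i ∈ Finset.range n, (w + t * q ^ i) =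
      ∑ k ∈ Finset.range (n + 1), gauss q n k * q ^ (k.choose 2) * t ^ k * w ^ (n - k) := by
  induction n with
  | zero => simp [gauss_zero_right]
  | succ n ih =>
    rw [Finset.prod_range_succ, ih, Finset.sum_range_succ' _ (n + 1)]
    have h1 : w * ∑ k ∈ Finset.range (n + 1), gauss q n k * q ^ (k.choose 2) * t ^ k * w ^ (n - k)
        = ∑ k ∈ Finset.range (n + 1 + 1),
          gauss q n k * q ^ (k.choose 2) * t ^ k * w ^ (n + 1 - k) := by
      rw [Finset.sum_range_succ _ (n + 1), gauss_eq_zero q (Nat.lt_succ_self n), Finset.mul_sum]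
      simp only [zero_mul, add_zero]
      refine Finset.sum_congr rfl fun k hk => ?_
      have hk' : k ≤ n := Nat.lt_succ_iff.1 (Finset.mem_range.1 hk)
      rw [Nat.succ_sub hk', pow_succ]
      ring
    rw [Finset.sum_range_succ' _ (n + 1)] at h1
    have h2 : t * q ^ n * ∑ k ∈ Finset.range (n + 1),
        gauss q n k * q ^ (k.choose 2) * t ^ k * w ^ (n - k)
        = ∑ k ∈ Finset.range (n + 1),
          q ^ (n - k) * gauss q n k * q ^ ((k + 1).choose 2) * t ^ (k + 1) * w ^ (n - k) := by
      rw [Finset.mul_sum]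
      refine Finset.sum_congr rfl fun k hk => ?_
      have hk' : k ≤ n := Nat.lt_succ_iff.1 (Finset.mem_range.1 hk)
      have : (k + 1).choose 2 = k + k.choose 2 := by
        rw [Nat.choose_succ_succ' k 1, Nat.choose_one_right]
      obtain ⟨l, rfl⟩ := Nat.exists_eq_add_of_le hk'
      rw [this, Nat.add_sub_cancel_left]
      ring
    have h3 : ∑ k ∈ Finset.range (n + 1),
        gauss q (n + 1) (k + 1) * q ^ ((k + 1).choose 2) * t ^ (k + 1) * w ^ (n + 1 - (k + 1)) =
        ∑ k ∈ Finset.range (n + 1),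
          gauss q n (k + 1) * q ^ ((k + 1).choose 2) * t ^ (k + 1) * w ^ (n + 1 - (k + 1)) +
        ∑ k ∈ Finset.range (n + 1),
          q ^ (n - k) * gauss q n k * q ^ ((k + 1).choose 2) * t ^ (k + 1) * w ^ (n - k) := by
      rw [← Finset.sum_add_distrib]
      refine Finset.sum_congr rfl fun k _ => ?_
      rw [gauss, Nat.add_sub_add_right]
      ring
    rw [h3]
    simp only [gauss_zero_right] at h1 ⊢
    linear_combination h1 + h2

end Gauss

/-! ### Euler's product and limits of Gaussian binomials -/

/-- Euler's product `∏_{n ≥ 1} (1 - q ^ n)`. -/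
noncomputable def euler : ℤ⟦X⟧ := ∏' n : ℕ, (1 - (X : ℤ⟦X⟧) ^ (n + 1))

theorem hasProd_euler : HasProd (fun n : ℕ => 1 - (X : ℤ⟦X⟧) ^ (n + 1)) euler :=
  (multipliable_one_sub_X_pow ℤ).hasProd

/-- Euler's product at `q ^ k`. -/
noncomputable def eulerAt (k : ℕ) [NeZero k] : ℤ⟦X⟧ := expand k (NeZero.ne k) euler

theorem hasProd_eulerAt (k : ℕ) [NeZero k] :
    HasProd (fun n : ℕ => 1 - ((X : ℤ⟦X⟧) ^ k) ^ (n + 1)) (eulerAt k) := by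
  simpa [Function.comp_def, eulerAt] using
    hasProd_euler.map (expand k (NeZero.ne k)) (continuous_expand (NeZero.ne k))

theorem constantCoeff_euler : constantCoeff euler = 1 := by
  have h := hasProd_euler.map (constantCoeff (R := ℤ)) (continuous_constantCoeff ℤ)
  have h1 : (constantCoeff (R := ℤ)) ∘ (fun n : ℕ => 1 - (X : ℤ⟦X⟧) ^ (n + 1)) = fun _ => 1 := by
    funext n; simp
  rw [h1] at h
  exact h.unique hasProd_one

theorem constantCoeff_eulerAt (k : ℕ) [NeZero k] : constantCoeff (eulerAt k) = 1 := by
  rw [eulerAt, constantCoeff_expand, constantCoeff_euler]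

theorem eulerAt_ne_zero (k : ℕ) [NeZero k] : eulerAt k ≠ 0 := fun h => by
  simpa [h] using constantCoeff_eulerAt k

theorem euler_ne_zero : euler ≠ 0 := fun h => by
  simpa [h] using constantCoeff_euler

theorem tendsto_qPoch (k : ℕ) [NeZero k] :
    Tendsto (qPoch ((X : ℤ⟦X⟧) ^ k)) atTop (𝓝 (eulerAt k)) :=
  (hasProd_eulerAt k).tendsto_prod_nat

theorem tendsto_iff_eventually_dvd {ι : Type*} {l : Filter ι} {f : ι → ℤ⟦X⟧} {g : ℤ⟦X⟧} :
    Tendsto f l (𝓝 g) ↔ ∀ d : ℕ, ∀ᶠ i in l, (X : ℤ⟦X⟧) ^ d ∣ f i - g := by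
  rw [tendsto_iff_eventually_coeff]
  constructor
  · intro h d
    have : ∀ᶠ i in l, ∀ m ∈ Finset.range d, coeff m (f i) = coeff m g := by
      rw [Filter.eventually_all_finset]
      exact fun m _ => h m
    filter_upwards [this] with i hi
    rw [X_pow_dvd_iff]
    intro m hm
    rw [map_sub, hi m (Finset.mem_range.2 hm), sub_self]
  · intro h d
    filter_upwards [h (d + 1)] with i hi
    have := X_pow_dvd_iff.1 hi d (Nat.lt_succ_self d)
    rwa [map_sub, sub_eq_zero] at this

/-- If `a, b, c → e` and `g a b = c`, then `g → 1 / e`. -/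
theorem tendsto_inv_of_mul_eq {ι : Type*} {l : Filter ι} {g a b c : ι → ℤ⟦X⟧} {e L : ℤ⟦X⟧}
    (hL : L * e = 1) (ha : Tendsto a l (𝓝 e)) (hb : Tendsto b l (𝓝 e)) (hc : Tendsto c l (𝓝 e))
    (h : ∀ᶠ i in l, g i * a i * b i = c i) : Tendsto g l (𝓝 L) := by
  rw [tendsto_iff_eventually_dvd] at ha hb hc ⊢
  intro d
  filter_upwards [ha d, hb d, hc d, h] with i hai hbi hci hi
  have key : g i - L = L ^ 2 * ((c i - e) - g i * ((a i - e) * b i + e * (b i - e))) := by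
    rw [← hi]
    linear_combination (-g i * L * e - g i + L) * hL
  rw [key]
  exact Dvd.dvd.mul_left (dvd_sub hci (Dvd.dvd.mul_left
    (dvd_add (Dvd.dvd.mul_right hai _) (Dvd.dvd.mul_left hbi _)) _)) _

/-- `1 / ∏_{n ≥ 1} (1 - q ^ (k n))`. -/
noncomputable def eulerInv (k : ℕ) [NeZero k] : ℤ⟦X⟧ := invOfUnit (eulerAt k) 1

theorem eulerInv_mul (k : ℕ) [NeZero k] : eulerInv k * eulerAt k = 1 := by
  rw [eulerInv, mul_comm]
  exact mul_invOfUnit _ _ (by simp [constantCoeff_eulerAt])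

theorem tendsto_gauss (k : ℕ) [NeZero k] (n : ℤ) :
    Tendsto (fun M : ℕ => gauss ((X : ℤ⟦X⟧) ^ k) (2 * M) (M + n).toNat) atTop (𝓝 (eulerInv k)) := by
  have hshift : ∀ n : ℤ, Tendsto (fun M : ℕ => ((M : ℤ) + n).toNat) atTop atTop := by
    intro n
    refine tendsto_atTop.2 fun b => ?_
    filter_upwards [eventually_ge_atTop (b + n.natAbs)] with M hM
    omega
  have h2 : Tendsto (fun M : ℕ => 2 * M) atTop atTop :=
    tendsto_atTop.2 fun b => by
      filter_upwards [eventually_ge_atTop b] with M hM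
      omega
  refine tendsto_inv_of_mul_eq (eulerInv_mul k) ((tendsto_qPoch k).comp (hshift n))
    ((tendsto_qPoch k).comp (hshift (-n))) ((tendsto_qPoch k).comp h2) ?_
  filter_upwards [eventually_ge_atTop n.natAbs] with M hM
  have : 2 * M = ((M : ℤ) + n).toNat + ((M : ℤ) + -n).toNat := by omega
  simp only [Function.comp_apply]
  rw [this]
  exact gauss_mul_qPoch _ _ _

/-! ### The Jacobi triple product and Jacobi's cube identity -/

/-- The exponent `s n (n - 1) / 2 + a n` in the Jacobi triple product with
factors `q ^ (s j + a)`, `q ^ (s j + s - a)` and `q ^ (s j + s)`. It is nonnegative for `a ≤ s`. -/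
def jacobiExp (s a : ℕ) (n : ℤ) : ℕ := (s * (n * (n - 1) / 2) + a * n).toNat

theorem two_mul_jacobiExp {s a : ℕ} (h : a ≤ s) (n : ℤ) :
    2 * (jacobiExp s a n : ℤ) = s * (n * (n - 1)) + 2 * a * n := by
  have h2 : 2 * (n * (n - 1) / 2) = n * (n - 1) := by
    refine Int.mul_ediv_cancel' ?_
    have := Int.even_mul_succ_self (n - 1)
    rw [sub_add_cancel, mul_comm] at this
    exact this.two_dvd
  have h0 : 0 ≤ 2 * ((s : ℤ) * (n * (n - 1) / 2) + a * n) := by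
    have e : 2 * ((s : ℤ) * (n * (n - 1) / 2) + a * n) = s * (n * (n - 1)) + 2 * a * n := by
      linear_combination (s : ℤ) * h2
    rw [e]
    have h' : (a : ℤ) ≤ s := by exact_mod_cast h
    have ha : (0 : ℤ) ≤ a := by positivity
    rcases lt_or_ge n 0 with hn | hn
    · nlinarith [mul_nonneg (by linarith : (0 : ℤ) ≤ s) (by nlinarith : (0 : ℤ) ≤ n * (n + 1))]
    · rcases hn.eq_or_lt with rfl | hn
      · simp
      · have : (0 : ℤ) ≤ n * (n - 1) := by nlinarith
        positivity
  rw [jacobiExp, Int.toNat_of_nonneg (by linarith)]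
  linear_combination (s : ℤ) * h2

theorem finite_jacobiExp_le {s a : ℕ} (hs : 1 ≤ s) (h : a ≤ s) (d : ℕ) :
    {n | jacobiExp s a n ≤ d}.Finite := by
  refine (Set.finite_Icc (-(2 * d + 1 : ℤ)) (2 * d + 1)).subset fun n hn => ?_
  have h1 := two_mul_jacobiExp h n
  have h2 : (jacobiExp s a n : ℤ) ≤ d := by exact_mod_cast hn
  have h' : (a : ℤ) ≤ s := by exact_mod_cast h
  have ha : (0 : ℤ) ≤ a := by positivity
  have hs' : (1 : ℤ) ≤ s := by exact_mod_cast hs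
  rw [Set.mem_Icc]
  constructor <;> by_contra! hc
  · have h3 : (0 : ℤ) < n * (n + 1) := by nlinarith
    have h4 : n * (n + 1) ≤ s * (n * (n + 1)) := by nlinarith
    nlinarith
  · have h3 : (0 : ℤ) < n * (n - 1) := by nlinarith
    have h4 : n * (n - 1) ≤ s * (n * (n - 1)) := by nlinarith
    nlinarith

theorem finite_jacobiExp_eq {s a : ℕ} (hs : 1 ≤ s) (h : a ≤ s) (d : ℕ) :
    {n | jacobiExp s a n = d}.Finite :=
  (finite_jacobiExp_le hs h d).subset fun _ hn => le_of_eq hn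

theorem sum_range_eq_sum_Icc {R : Type*} [AddCommMonoid R] (f : ℕ → R) (M : ℕ) :
    ∑ k ∈ Finset.range (2 * M + 1), f k =
      ∑ n ∈ Finset.Icc (-(M : ℤ)) M, f ((M : ℤ) + n).toNat := by
  refine Finset.sum_bij' (fun k _ => (k : ℤ) - M) (fun n _ => ((M : ℤ) + n).toNat) ?_ ?_ ?_ ?_ ?_
  · intro k hk; simp at hk ⊢; omega
  · intro n hn; simp at hn ⊢; omega
  · intro k hk; simp
  · intro n hn; simp at hn ⊢; omega
  · intro k hk; simp

theorem eventually_mem_Icc (n : ℤ) : ∀ᶠ M : ℕ in atTop, n ∈ Finset.Icc (-(M : ℤ)) M := by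
  filter_upwards [eventually_ge_atTop n.natAbs] with M hM
  rw [Finset.mem_Icc]
  omega

theorem two_mul_choose_two (k : ℕ) : 2 * (k.choose 2 : ℤ) = k * (k - 1) := by
  induction k with
  | zero => simp
  | succ k ih =>
    rw [Nat.choose_succ_succ' k 1, Nat.choose_one_right]
    push_cast
    linarith

theorem jacobiExp_add {s a M : ℕ} (hM : 1 ≤ M) (h : a ≤ s) {n : ℤ}
    (hn : n ∈ Finset.Icc (-(M : ℤ)) M) :
    s * ((M : ℤ) + n).toNat.choose 2 + (s * M - a) * (2 * M - ((M : ℤ) + n).toNat) =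
      M * (s * M - a) + s * M.choose 2 + jacobiExp s a n := by
  rw [Finset.mem_Icc] at hn
  obtain ⟨k, hk⟩ : ∃ k : ℕ, (k : ℤ) = M + n := ⟨((M : ℤ) + n).toNat, by omega⟩
  rw [← hk, Int.toNat_natCast]
  have h1 := two_mul_jacobiExp h n
  have h2 := two_mul_choose_two k
  have h3 := two_mul_choose_two M
  have hM' : a ≤ s * M := h.trans (Nat.le_mul_of_pos_right s hM)
  have hk' : k ≤ 2 * M := by omega
  zify [hM', hk']
  have hn' : n = k - M := by omega
  subst hn'
  refine mul_left_cancel₀ (two_ne_zero (α := ℤ)) ?_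
  linear_combination (s : ℤ) * h2 - s * h3 - h1

theorem sign_pow_natAbs {ε : ℤ} (hε : ε * ε = 1) {M : ℕ} {n : ℤ}
    (hn : n ∈ Finset.Icc (-(M : ℤ)) M) :
    ε ^ ((M : ℤ) + n).toNat = ε ^ M * ε ^ n.natAbs := by
  rw [Finset.mem_Icc] at hn
  have h2 : ∀ k : ℕ, ε ^ (2 * k) = 1 := fun k => by rw [pow_mul, pow_two, hε, one_pow]
  rw [← pow_add]
  rcases le_total 0 n with h | h
  · congr 1; omega
  · have : M + n.natAbs = ((M : ℤ) + n).toNat + 2 * n.natAbs := by omega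
    rw [this, pow_add, h2, mul_one]

theorem prod_range_monomial (ε : ℤ) (s M : ℕ) :
    ∏ i ∈ Finset.range M, (C ε * ((X : ℤ⟦X⟧) ^ s) ^ i) = C (ε ^ M) * X ^ (s * M.choose 2) := by
  rw [Finset.prod_mul_distrib, Finset.prod_pow_eq_pow_sum, Finset.prod_const, Finset.card_range,
    Finset.sum_range_id, ← Nat.choose_two_right, ← pow_mul, map_pow]

/-- The finite form of the Jacobi triple product. -/
theorem prod_mul_prod_eq_sum_gauss {s a M : ℕ} (hs : 1 ≤ s) (h : a ≤ s) (hM : 1 ≤ M) {ε : ℤ}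
    (hε : ε * ε = 1) :
    (∏ j ∈ Finset.range M, (1 + monomial (s * j + a) ε : ℤ⟦X⟧)) *
      (∏ j ∈ Finset.range M, (1 + monomial (s * j + (s - a)) ε : ℤ⟦X⟧)) =
    ∑ n ∈ Finset.Icc (-(M : ℤ)) M, monomial (jacobiExp s a n) (ε ^ n.natAbs) *
      gauss ((X : ℤ⟦X⟧) ^ s) (2 * M) ((M : ℤ) + n).toNat := by
  have hM' : a ≤ s * M := h.trans (Nat.le_mul_of_pos_right s hM)
  have key := prod_add_mul_pow ((X : ℤ⟦X⟧) ^ s) (X ^ (s * M - a)) (C ε) (2 * M)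
  rw [sum_range_eq_sum_Icc, two_mul M, Finset.prod_range_add,
    ← Finset.prod_range_reflect _ M] at key
  have hCε : (C ε * C ε : ℤ⟦X⟧) = 1 := by rw [← map_mul, hε, map_one]
  have e1 : ∏ j ∈ Finset.range M,
        ((X : ℤ⟦X⟧) ^ (s * M - a) + C ε * ((X : ℤ⟦X⟧) ^ s) ^ (M - 1 - j)) =
      (C (ε ^ M) * X ^ (s * M.choose 2)) *
        ∏ j ∈ Finset.range M, (1 + monomial (s * j + (s - a)) ε : ℤ⟦X⟧) := by
    rw [← prod_range_monomial,
      ← Finset.prod_range_reflect (fun i => C ε * ((X : ℤ⟦X⟧) ^ s) ^ i) M,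
      ← Finset.prod_mul_distrib]
    refine Finset.prod_congr rfl fun j hj => ?_
    have hj' := Finset.mem_range.1 hj
    have : s * M - a = s * (M - 1 - j) + (s * j + (s - a)) := by
      obtain ⟨m, rfl⟩ := Nat.exists_eq_add_of_lt hj'
      obtain ⟨b, rfl⟩ := Nat.exists_eq_add_of_le h
      have e1 : j + m + 1 - 1 - j = m := by omega
      have e2 : a + b - a = b := by omega
      rw [e1, e2]
      have : (a + b) * (j + m + 1) = a + ((a + b) * m + ((a + b) * j + b)) := by ring
      rw [this, Nat.add_sub_cancel_left]
    rw [this, monomial_eq_C_mul_X_pow]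
    linear_combination (-(X : ℤ⟦X⟧) ^ (s * (M - 1 - j) + (s * j + (s - a)))) * hCε
  have e2 : ∏ j ∈ Finset.range M,
        ((X : ℤ⟦X⟧) ^ (s * M - a) + C ε * ((X : ℤ⟦X⟧) ^ s) ^ (M + j)) =
      X ^ (M * (s * M - a)) *
        ∏ j ∈ Finset.range M, (1 + monomial (s * j + a) ε : ℤ⟦X⟧) := by
    have : (X : ℤ⟦X⟧) ^ (M * (s * M - a)) = ∏ j ∈ Finset.range M, (X : ℤ⟦X⟧) ^ (s * M - a) := by
      rw [Finset.prod_const, Finset.card_range, ← pow_mul, mul_comm]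
    rw [this, ← Finset.prod_mul_distrib]
    refine Finset.prod_congr rfl fun j hj => ?_
    have e : s * (M + j) = (s * M - a) + (s * j + a) := by
      rw [mul_add]; omega
    rw [← pow_mul, e, monomial_eq_C_mul_X_pow]
    ring
  rw [e1, e2, ← two_mul M] at key
  have hne : (C (ε ^ M) * X ^ (M * (s * M - a) + s * M.choose 2) : ℤ⟦X⟧) ≠ 0 := by
    refine mul_ne_zero ?_ (pow_ne_zero _ X_ne_zero)
    rw [Ne, map_eq_zero_iff _ C_injective]
    exact pow_ne_zero _ fun h => by simp [h] at hε
  refine mul_left_cancel₀ hne ?_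
  rw [Finset.mul_sum]
  calc _ = _ := by ring
    _ = _ := key
    _ = _ := by
      refine Finset.sum_congr rfl fun n hn => ?_
      have e3 := jacobiExp_add hM h hn
      have e4 := sign_pow_natAbs hε hn
      have e5 : ((X : ℤ⟦X⟧) ^ s) ^ ((M : ℤ) + n).toNat.choose 2 *
          ((X : ℤ⟦X⟧) ^ (s * M - a)) ^ (2 * M - ((M : ℤ) + n).toNat) =
          X ^ (M * (s * M - a) + s * M.choose 2) * X ^ jacobiExp s a n := by
        rw [← pow_mul, ← pow_mul, ← pow_add, ← pow_add, e3]
      rw [monomial_eq_C_mul_X_pow, ← map_pow, e4, map_mul]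
      linear_combination (gauss ((X : ℤ⟦X⟧) ^ s) (2 * M) ((M : ℤ) + n).toNat * C (ε ^ M) *
        C (ε ^ n.natAbs)) * e5

/-! ### Products over residue classes -/

/-- The product `∏_{j ≥ 0} (1 + ε q ^ (s j + a))`. -/
noncomputable def residueProd (s a : ℕ) (ε : ℤ) : ℤ⟦X⟧ :=
  ∏' j : ℕ, (1 + monomial (s * j + a) ε)

theorem hasProd_residueProd {s : ℕ} (hs : 1 ≤ s) (a : ℕ) (ε : ℤ) :
    HasProd (fun j : ℕ => (1 + monomial (s * j + a) ε : ℤ⟦X⟧)) (residueProd s a ε) := by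
  refine (multipliable_one_add_of_tendsto_order_atTop_nhds_top ℤ ?_).hasProd
  refine ENat.tendsto_nhds_top_iff_natCast_lt.mpr fun n => ?_
  filter_upwards [eventually_gt_atTop n] with m hm
  refine lt_of_lt_of_le (Nat.cast_lt.2 hm) (nat_le_order _ _ fun i hi => ?_)
  rw [coeff_monomial, if_neg]
  have : m ≤ s * m := Nat.le_mul_of_pos_left m hs
  omega

/-- A residue class modulo `s` splits into `k` residue classes modulo `k s`. -/
theorem prod_residueProd {s k : ℕ} (hs : 1 ≤ s) (hk : 1 ≤ k) (a : ℕ) (ε : ℤ) :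
    ∏ i ∈ Finset.range k, residueProd (k * s) (a + s * i) ε = residueProd s a ε := by
  have h1 := (hasProd_prod (s := Finset.range k) fun i _ =>
    hasProd_residueProd (Nat.mul_pos hk hs) (a + s * i) ε).tendsto_prod_nat
  have h2 := (hasProd_residueProd hs a ε).tendsto_prod_nat.comp
    (tendsto_id.const_mul_atTop' hk)
  refine tendsto_nhds_unique h1 (h2.congr fun M => ?_)
  simp only [Function.comp_apply, id]
  induction M with
  | zero => simp
  | succ M ih =>
    rw [mul_add_one, Finset.prod_range_add, ih, Finset.prod_range_succ]
    congr 1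
    refine Finset.prod_congr rfl fun i _ => ?_
    rw [show k * s * M + (a + s * i) = s * (k * M + i) + a by ring]

theorem expand_residueProd {s k : ℕ} (hs : 1 ≤ s) (hk : k ≠ 0) (a : ℕ) (ε : ℤ) :
    expand k hk (residueProd s a ε) = residueProd (k * s) (k * a) ε := by
  have h1 := (hasProd_residueProd hs a ε).map (expand k hk) (continuous_expand hk)
  refine h1.unique ?_
  convert hasProd_residueProd (Nat.mul_pos (Nat.pos_of_ne_zero hk) hs) (k * a) ε using 2 with j
  simp only [Function.comp_apply, map_add, map_one, expand_monomial]
  rw [show k * (s * j + a) = k * s * j + k * a by ring]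

theorem residueProd_self (s : ℕ) [NeZero s] : residueProd s s (-1) = eulerAt s := by
  refine (hasProd_residueProd (Nat.one_le_iff_ne_zero.2 (NeZero.ne s)) s (-1)).unique ?_
  convert hasProd_eulerAt s using 2 with j
  rw [← pow_mul, monomial_eq_C_mul_X_pow, mul_add_one]
  simp [sub_eq_add_neg]

theorem eulerAt_one : eulerAt 1 = euler := by rw [eulerAt, expand_one_apply]

/-- `∏ (1 + q ^ n) ∏ (1 - q ^ n) = ∏ (1 - q ^ (2 n))`. -/
theorem residueProd_one_one_mul_euler : residueProd 1 1 1 * euler = eulerAt 2 := by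
  rw [← eulerAt_one, ← residueProd_self 1]
  refine ((hasProd_residueProd le_rfl 1 1).mul (hasProd_residueProd le_rfl 1 (-1))).unique ?_
  convert hasProd_eulerAt 2 using 2 with j
  simp only [monomial_eq_C_mul_X_pow, one_mul, map_neg, map_one]
  ring

/-- The **Jacobi triple product** identity, specialised to powers of `q` and a sign `ε`. -/
theorem hasSum_jacobi (s a : ℕ) [NeZero s] (h : a ≤ s) {ε : ℤ} (hε : ε * ε = 1) :
    HasSum (fun n : ℤ => monomial (jacobiExp s a n) (ε ^ n.natAbs))
      (residueProd s a ε * residueProd s (s - a) ε * eulerAt s) := by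
  have hs : 1 ≤ s := Nat.one_le_iff_ne_zero.2 (NeZero.ne s)
  have hsum := (summable_monomial (fun n : ℤ => ε ^ n.natAbs) (finite_jacobiExp_eq hs h)).hasSum
  have h1 := tendsto_sum_monomial_mul (finite_jacobiExp_le hs h) hsum eventually_mem_Icc
    (fun n => tendsto_gauss s n)
  have h2 := ((hasProd_residueProd hs a ε).tendsto_prod_nat).mul
    (hasProd_residueProd hs (s - a) ε).tendsto_prod_nat
  have h3 := tendsto_nhds_unique (h2.congr' ?_) h1
  · rw [h3, mul_assoc, eulerInv_mul, mul_one]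
    exact hsum
  · filter_upwards [eventually_ge_atTop 1] with M hM
    exact prod_mul_prod_eq_sum_gauss hs h hM hε

theorem gauss_map {R S : Type*} [CommRing R] [CommRing S] (f : R →+* S) (q : R) :
    ∀ n k, gauss (f q) n k = f (gauss q n k)
  | n, 0 => by simp [gauss_zero_right]
  | 0, k + 1 => by simp [gauss]
  | n + 1, k + 1 => by simp [gauss, gauss_map f q n]

/-- The derivative of the finite triple product at a zero of one of its factors. -/
theorem sum_mul_gauss_eq_neg_qPoch {M : ℕ} (hM : 1 ≤ M) :
    ∑ n ∈ Finset.Icc (-(M : ℤ)) M, monomial (jacobiExp 1 0 n) ((-1) ^ n.natAbs * n) *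
      gauss ((X : ℤ⟦X⟧) ^ 1) (2 * M) ((M : ℤ) + n).toNat =
    -(qPoch ((X : ℤ⟦X⟧) ^ 1) (M - 1) * qPoch ((X : ℤ⟦X⟧) ^ 1) M) := by
  obtain ⟨m, rfl⟩ : ∃ m, M = m + 1 := ⟨M - 1, by omega⟩
  set q : ℤ⟦X⟧ := X with hq
  have key := prod_add_mul_pow (Polynomial.C q) (Polynomial.C (q ^ (m + 1))) (-Polynomial.X)
    (2 * (m + 1))
  have hterm : ∀ k, gauss (Polynomial.C q) (2 * (m + 1)) k * Polynomial.C q ^ k.choose 2 *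
      (-Polynomial.X) ^ k * Polynomial.C (q ^ (m + 1)) ^ (2 * (m + 1) - k) =
      Polynomial.C (gauss q (2 * (m + 1)) k * q ^ k.choose 2 * (-1) ^ k *
        (q ^ (m + 1)) ^ (2 * (m + 1) - k)) * Polynomial.X ^ k := by
    intro k
    rw [gauss_map, neg_pow (Polynomial.X : Polynomial ℤ⟦X⟧)]
    simp only [map_mul, map_pow, map_neg, map_one]
    ring
  simp only [hterm] at key
  have key0 := congrArg (Polynomial.eval 1) key
  have key1 := congrArg (fun p => Polynomial.eval 1 (Polynomial.derivative p)) key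
  have hfac : ∏ i ∈ Finset.range (2 * (m + 1)),
      (Polynomial.C (q ^ (m + 1)) + -Polynomial.X * Polynomial.C q ^ i) =
      (1 - Polynomial.X) * (Polynomial.C (q ^ (m + 1)) *
        ((∏ i ∈ Finset.range (m + 1),
          (Polynomial.C (q ^ (m + 1)) + -Polynomial.X * Polynomial.C q ^ i)) *
        ∏ j ∈ Finset.range m,
          (Polynomial.C (q ^ (m + 1)) + -Polynomial.X * Polynomial.C q ^ (m + 1 + (j + 1))))) := by
    rw [two_mul, Finset.prod_range_add, Finset.prod_range_succ' (fun j =>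
      Polynomial.C (q ^ (m + 1)) + -Polynomial.X * Polynomial.C q ^ (m + 1 + j)) m, map_pow]
    ring
  have hneg : ∏ i ∈ Finset.range (m + 1), (q ^ (m + 1) + -q ^ i) =
      (-1) ^ (m + 1) * q ^ (m + 1).choose 2 * qPoch (q ^ 1) (m + 1) := by
    have := prod_range_monomial (-1) 1 (m + 1)
    simp only [pow_one, map_neg, map_one, one_mul, map_pow] at this
    rw [← this, qPoch, ← Finset.prod_range_reflect (fun i => q ^ (m + 1) + -q ^ i),
      ← Finset.prod_range_reflect (fun i => -1 * q ^ i), ← Finset.prod_mul_distrib]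
    refine Finset.prod_congr rfl fun j hj => ?_
    have := Finset.mem_range.1 hj
    have e : m + 1 = (m + 1 - 1 - j) + (j + 1) := by omega
    have e' : q ^ (m + 1) = q ^ (m + 1 - 1 - j) * q ^ (j + 1) := by rw [← pow_add, ← e]
    rw [e']
    ring
  have hpos : ∏ j ∈ Finset.range m, (q ^ (m + 1) + -q ^ (m + 1 + (j + 1))) =
      q ^ ((m + 1) * m) * qPoch (q ^ 1) m := by
    rw [pow_mul, ← Finset.card_range m, ← Finset.prod_const, Finset.card_range, qPoch,
      ← Finset.prod_mul_distrib]
    refine Finset.prod_congr rfl fun j hj => ?_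
    ring
  rw [hfac] at key0 key1
  simp only [Polynomial.derivative_mul, Polynomial.derivative_sub, Polynomial.derivative_one,
    Polynomial.derivative_X, Polynomial.eval_add, Polynomial.eval_mul, Polynomial.eval_sub,
    Polynomial.eval_one, Polynomial.eval_X, Polynomial.eval_prod, Polynomial.eval_C,
    Polynomial.eval_neg, Polynomial.eval_pow, sub_self, zero_mul, Polynomial.eval_finsetSum,
    Polynomial.derivative_sum, Polynomial.derivative_C, Polynomial.derivative_X_pow,
    zero_sub, zero_add, add_zero, neg_mul, one_mul, one_pow, mul_one] at key0 key1
  rw [hneg, hpos, sum_range_eq_sum_Icc] at key1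
  rw [sum_range_eq_sum_Icc] at key0
  have hne : ((-1) ^ (m + 1) * q ^ ((m + 1) * (m + 1) + (m + 1).choose 2) : ℤ⟦X⟧) ≠ 0 :=
    mul_ne_zero (pow_ne_zero _ (by simp)) (pow_ne_zero _ X_ne_zero)
  refine mul_left_cancel₀ hne ?_
  have key2 := key1.trans ((sub_zero _).symm.trans (congrArg (_ - ·)
    ((mul_zero ((m : ℤ⟦X⟧) + 1)).symm.trans (congrArg (((m : ℤ⟦X⟧) + 1) * ·) key0))))
  rw [Finset.mul_sum, ← Finset.sum_sub_distrib] at key2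
  rw [Finset.mul_sum, Nat.add_sub_cancel]
  refine Eq.trans ?_ (key2.symm.trans ?_)
  · refine Finset.sum_congr rfl fun n hn => ?_
    have e3 := jacobiExp_add (s := 1) (a := 0) hM (by omega) hn
    have e4 := sign_pow_natAbs (ε := -1) (by norm_num) hn
    have e4' : ((-1 : ℤ⟦X⟧)) ^ (((m + 1 : ℕ) : ℤ) + n).toNat =
        (-1) ^ (m + 1) * (-1) ^ n.natAbs := by
      have := congrArg (Int.cast : ℤ → ℤ⟦X⟧) e4
      push_cast at this
      exact_mod_cast this
    have e5 : q ^ (((m + 1 : ℕ) : ℤ) + n).toNat.choose 2 *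
        (q ^ (m + 1)) ^ (2 * (m + 1) - (((m + 1 : ℕ) : ℤ) + n).toNat) =
        q ^ ((m + 1) * (m + 1) + (m + 1).choose 2) * q ^ jacobiExp 1 0 n := by
      rw [← pow_mul, ← pow_add, ← pow_add]
      congr 1
      simpa using e3
    have e6 : (((((m + 1 : ℕ) : ℤ) + n).toNat : ℕ) : ℤ⟦X⟧) = (m : ℤ⟦X⟧) + 1 + (n : ℤ⟦X⟧) := by
      rw [Finset.mem_Icc] at hn
      have : ((((((m + 1 : ℕ) : ℤ) + n).toNat : ℕ) : ℤ)) = m + 1 + n := by omega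
      have := congrArg (Int.cast : ℤ → ℤ⟦X⟧) this
      push_cast at this
      exact_mod_cast this
    have e7 : monomial (jacobiExp 1 0 n) ((-1) ^ n.natAbs * n) =
        ((-1) ^ n.natAbs * (n : ℤ⟦X⟧)) * q ^ jacobiExp 1 0 n := by
      rw [monomial_eq_C_mul_X_pow, ← hq]; simp
    rw [e7, e6, e4', pow_one]
    linear_combination (-(n : ℤ⟦X⟧)) * gauss q (2 * (m + 1)) (((m + 1 : ℕ) : ℤ) + n).toNat *
      (-1) ^ (m + 1) * (-1) ^ n.natAbs * e5
  · rw [show (m + 1) * (m + 1) = (m + 1) + (m + 1) * m by ring, pow_add, pow_add]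
    ring

/-- **Jacobi's identity** for the cube of Euler's product. -/
theorem hasSum_jacobi_cube :
    HasSum (fun n : ℤ => monomial (jacobiExp 1 0 n) ((-1) ^ n.natAbs * n)) (-euler ^ 3) := by
  have hsum := (summable_monomial (fun n : ℤ => (-1) ^ n.natAbs * n)
    (finite_jacobiExp_eq (le_refl 1) (Nat.zero_le 1))).hasSum
  have h1 := tendsto_sum_monomial_mul (finite_jacobiExp_le (le_refl 1) (Nat.zero_le 1)) hsum
    eventually_mem_Icc (fun n => tendsto_gauss 1 n)
  have hP := tendsto_qPoch 1
  have h2 := ((hP.comp (tendsto_sub_atTop_nat 1)).mul hP).neg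
  have h3 := tendsto_nhds_unique (h2.congr' ?_) h1
  · have he : eulerAt 1 = euler := by rw [eulerAt, expand_one_apply]
    have h4 := eulerInv_mul 1
    rw [he] at h3 h4
    have : (∑' n : ℤ, monomial (jacobiExp 1 0 n) ((-1) ^ n.natAbs * n) : ℤ⟦X⟧) = -euler ^ 3 := by
      linear_combination (-(∑' n : ℤ, monomial (jacobiExp 1 0 n) ((-1) ^ n.natAbs * n) : ℤ⟦X⟧)) * h4
        - euler * h3
    rwa [this] at hsum
  · filter_upwards [eventually_ge_atTop 1] with M hM
    exact (sum_mul_gauss_eq_neg_qPoch hM).symm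

/-! ### Theta series in one and two variables -/

theorem finite_sq_le (n : ℕ) : {x : ℤ | x.natAbs ^ 2 ≤ n}.Finite := by
  refine (Set.finite_Icc (-(n : ℤ)) n).subset fun x hx => ?_
  rw [Set.mem_ofPred_eq] at hx
  have : x.natAbs ≤ n := (Nat.le_self_pow two_ne_zero _).trans hx
  rw [Set.mem_Icc]
  omega

theorem finite_sq_add_sq_le (n : ℕ) :
    {p : ℤ × ℤ | p.1.natAbs ^ 2 + p.2.natAbs ^ 2 ≤ n}.Finite := by
  refine ((finite_sq_le n).prod (finite_sq_le n)).subset fun p hp => ?_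
  simp only [Set.mem_ofPred_eq, Set.mem_prod] at hp ⊢
  omega

/-- The weighted theta series `∑_{x ∈ ℤ} α x q ^ (x ^ 2)`. -/
noncomputable def theta (α : ℤ → ℤ) : ℤ⟦X⟧ := ∑' x : ℤ, monomial (x.natAbs ^ 2) (α x)

/-- The weighted theta series `∑_{(x, y) ∈ ℤ²} w x y q ^ (x ^ 2 + y ^ 2)`. -/
noncomputable def theta₂ (w : ℤ → ℤ → ℤ) : ℤ⟦X⟧ :=
  ∑' p : ℤ × ℤ, monomial (p.1.natAbs ^ 2 + p.2.natAbs ^ 2) (w p.1 p.2)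

theorem hasSum_theta (α : ℤ → ℤ) :
    HasSum (fun x : ℤ => monomial (x.natAbs ^ 2) (α x)) (theta α) :=
  (summable_monomial α fun n => (finite_sq_le n).subset fun _ h => le_of_eq h).hasSum

theorem hasSum_theta₂ (w : ℤ → ℤ → ℤ) :
    HasSum (fun p : ℤ × ℤ => monomial (p.1.natAbs ^ 2 + p.2.natAbs ^ 2) (w p.1 p.2))
      (theta₂ w) :=
  (summable_monomial (fun p : ℤ × ℤ => w p.1 p.2)
    fun n => (finite_sq_add_sq_le n).subset fun _ h => le_of_eq h).hasSum

theorem theta_mul_theta (α β : ℤ → ℤ) : theta α * theta β = theta₂ fun x y => α x * β y :=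
  (HasSum.monomial_mul (hasSum_theta α) (hasSum_theta β) finite_sq_le finite_sq_le).unique
    (hasSum_theta₂ fun x y => α x * β y)

theorem eulerD_theta (α : ℤ → ℤ) : eulerD (theta α) = theta fun x => x ^ 2 * α x := by
  refine (HasSum.eulerD_monomial (hasSum_theta α)).unique ?_
  convert hasSum_theta fun x => x ^ 2 * α x using 3 with x
  push_cast
  rw [sq_abs]

theorem theta₂_add (w w' : ℤ → ℤ → ℤ) :
    theta₂ (fun x y => w x y + w' x y) = theta₂ w + theta₂ w' := by
  refine (hasSum_theta₂ _).unique ?_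
  simpa only [map_add] using (hasSum_theta₂ w).add (hasSum_theta₂ w')

theorem theta₂_sub (w w' : ℤ → ℤ → ℤ) :
    theta₂ (fun x y => w x y - w' x y) = theta₂ w - theta₂ w' := by
  refine (hasSum_theta₂ _).unique ?_
  simpa only [map_sub] using (hasSum_theta₂ w).sub (hasSum_theta₂ w')

theorem theta₂_const_mul (k : ℤ) (w : ℤ → ℤ → ℤ) :
    theta₂ (fun x y => k * w x y) = (k : ℤ⟦X⟧) * theta₂ w := by
  refine (hasSum_theta₂ _).unique ?_
  refine Eq.mpr (congrArg (HasSum · _) (funext fun p => ?_))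
    ((hasSum_theta₂ w).mul_left (k : ℤ⟦X⟧))
  rw [monomial_eq_C_mul_X_pow, monomial_eq_C_mul_X_pow, map_mul]
  simp [mul_assoc]

theorem theta₂_comp_equiv (w : ℤ → ℤ → ℤ) (σ : ℤ × ℤ ≃ ℤ × ℤ)
    (hσ : ∀ p, (σ p).1.natAbs ^ 2 + (σ p).2.natAbs ^ 2 = p.1.natAbs ^ 2 + p.2.natAbs ^ 2) :
    theta₂ (fun x y => w (σ (x, y)).1 (σ (x, y)).2) = theta₂ w := by
  refine (hasSum_theta₂ _).unique ?_
  have := σ.hasSum_iff.2 (hasSum_theta₂ w)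
  simpa only [Function.comp_def, hσ] using this

theorem theta₂_swap (w : ℤ → ℤ → ℤ) : theta₂ (fun x y => w y x) = theta₂ w :=
  theta₂_comp_equiv w (Equiv.prodComm ℤ ℤ) fun p => by simp [add_comm]

theorem theta₂_neg_left (w : ℤ → ℤ → ℤ) : theta₂ (fun x y => w (-x) y) = theta₂ w :=
  theta₂_comp_equiv w ((Equiv.neg ℤ).prodCongr (Equiv.refl ℤ)) fun p => by simp

theorem theta₂_neg_right (w : ℤ → ℤ → ℤ) : theta₂ (fun x y => w x (-y)) = theta₂ w :=
  theta₂_comp_equiv w ((Equiv.refl ℤ).prodCongr (Equiv.neg ℤ)) fun p => by simp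

/-- The sum of a weight over the eight symmetries of the square lattice. -/
def symmSum (w : ℤ → ℤ → ℤ) (x y : ℤ) : ℤ :=
  w x y + w (-x) y + (w x (-y) + w (-x) (-y)) + (w y x + w (-y) x + (w y (-x) + w (-y) (-x)))

theorem theta₂_symmSum (w : ℤ → ℤ → ℤ) : theta₂ (symmSum w) = 8 * theta₂ w := by
  have h1 : ∀ v : ℤ → ℤ → ℤ, theta₂ (fun x y => v x y + v (-x) y) = 2 * theta₂ v := fun v => by
    rw [theta₂_add, theta₂_neg_left v]; ring
  have h2 : ∀ v : ℤ → ℤ → ℤ, theta₂ (fun x y => v x y + v x (-y)) = 2 * theta₂ v := fun v => by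
    rw [theta₂_add, theta₂_neg_right v]; ring
  have h3 : ∀ v : ℤ → ℤ → ℤ, theta₂ (fun x y => v x y + v y x) = 2 * theta₂ v := fun v => by
    rw [theta₂_add, theta₂_swap v]; ring
  have e : theta₂ (symmSum w) = theta₂ (fun x y =>
      (fun x y => (fun x y => w x y + w (-x) y) x y + (fun x y => w x y + w (-x) y) x (-y)) x y +
      (fun x y => (fun x y => w x y + w (-x) y) x y + (fun x y => w x y + w (-x) y) x (-y)) y x) :=
    rfl
  rw [e, h3, h2, h1]
  ring

/-- Two weights that agree after symmetrisation have the same theta series. -/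
theorem theta₂_eq_of_symmSum_eq {w w' : ℤ → ℤ → ℤ} (h : ∀ x y, symmSum w x y = symmSum w' x y) :
    theta₂ w = theta₂ w' := by
  have h8 : (8 : ℤ⟦X⟧) * theta₂ w = 8 * theta₂ w' := by
    rw [← theta₂_symmSum, ← theta₂_symmSum, funext₂ h]
  refine mul_left_cancel₀ ?_ h8
  have : (8 : ℤ⟦X⟧) = C 8 := by simp
  rw [this, Ne, map_eq_zero_iff _ C_injective]
  norm_num

/-- Multiplication by the Gaussian integer `2 - i`, of norm `5`, is a bijection from `ℤ²` onto the
sublattice `y ≡ 2 x (mod 5)` that multiplies `x² + y²` by `5`. -/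
theorem expand_five_theta₂ {w w' : ℤ → ℤ → ℤ} (h : ∀ u v, w' (2 * u + v) (2 * v - u) = w u v)
    (h0 : ∀ x y, ¬ (5 : ℤ) ∣ 2 * x - y → w' x y = 0) :
    expand 5 (by norm_num) (theta₂ w) = theta₂ w' := by
  refine (HasSum.expand_monomial (hasSum_theta₂ w) (by norm_num)).unique ?_
  have hinj : Function.Injective fun p : ℤ × ℤ => (2 * p.1 + p.2, 2 * p.2 - p.1) := by
    rintro ⟨a, b⟩ ⟨c, d⟩ hp
    simp only [Prod.mk.injEq] at hp ⊢
    omega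
  have := (hinj.hasSum_iff (f := fun p : ℤ × ℤ =>
    (monomial (p.1.natAbs ^ 2 + p.2.natAbs ^ 2) (w' p.1 p.2) : ℤ⟦X⟧)) ?_).2 (hasSum_theta₂ w')
  · refine Eq.mpr (congrArg (HasSum · _) (funext fun p => ?_)) this
    simp only [Function.comp_apply, h]
    congr 2
    zify
    simp only [sq_abs]
    ring
  · rintro ⟨x, y⟩ hp
    rw [h0, map_zero]
    rintro ⟨k, hk⟩
    refine hp ⟨(k, x - 2 * k), ?_⟩
    simp only [Prod.mk.injEq]
    simp only at hk
    omega

theorem expand_twentyFive_theta {α β : ℤ → ℤ} (h : ∀ x, β (5 * x) = α x)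
    (h0 : ∀ x, ¬ (5 : ℤ) ∣ x → β x = 0) :
    expand 25 (by norm_num) (theta α) = theta β := by
  refine (HasSum.expand_monomial (hasSum_theta α) (by norm_num)).unique ?_
  have hinj : Function.Injective fun x : ℤ => 5 * x := fun a b hab => by
    simp only at hab
    omega
  have := (hinj.hasSum_iff (f := fun x : ℤ => (monomial (x.natAbs ^ 2) (β x) : ℤ⟦X⟧)) ?_).2
    (hasSum_theta β)
  · refine Eq.mpr (congrArg (HasSum · _) (funext fun p => ?_)) this
    simp only [Function.comp_apply, h]
    congr 2
    zify
    simp only [sq_abs]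
    ring
  · rintro x hx
    rw [h0, map_zero]
    rintro ⟨k, rfl⟩
    exact hx ⟨k, rfl⟩

/-- Completing the square in the exponent turns a one-variable theta series into a sum over
squares in a residue class. -/
theorem X_pow_mul_expand_eq_theta {e : ℤ → ℕ} {a : ℤ → ℤ} {f : ℤ⟦X⟧}
    (hf : HasSum (fun n : ℤ => monomial (e n) (a n)) f) {L : ℕ} (hL : L ≠ 0) {r : ℕ} {p t : ℤ}
    (hp : p ≠ 0) (he : ∀ n, (r : ℤ) + L * e n = (p * n + t) ^ 2) {α : ℤ → ℤ}
    (hα : ∀ n, α (p * n + t) = a n) (hα0 : ∀ x, ¬ p ∣ x - t → α x = 0) :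
    (X : ℤ⟦X⟧) ^ r * expand L hL f = theta α := by
  refine (HasSum.X_pow_mul_monomial (HasSum.expand_monomial hf hL) r).unique ?_
  have hinj : Function.Injective fun x : ℤ => p * x + t := fun a b hab => by
    simpa [hp] using hab
  have := (hinj.hasSum_iff (f := fun x : ℤ => (monomial (x.natAbs ^ 2) (α x) : ℤ⟦X⟧)) ?_).2
    (hasSum_theta α)
  · refine Eq.mpr (congrArg (HasSum · _) (funext fun n => ?_)) this
    simp only [Function.comp_apply, hα]
    congr 2
    have := he n
    zify
    rw [sq_abs, this]
  · rintro x hx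
    rw [hα0, map_zero]
    rintro ⟨k, hk⟩
    exact hx ⟨k, by simp only; omega⟩

theorem neg_one_pow_natAbs (n : ℤ) : (-1 : ℤ) ^ n.natAbs = if n % 2 = 0 then 1 else -1 := by
  split_ifs with h
  · exact Even.neg_one_pow (Int.natAbs_even.2 (Int.even_iff.2 h))
  · exact Odd.neg_one_pow (Int.natAbs_odd.2 (Int.odd_iff.2 (by omega)))

/-! ### Quadratic theta identities of level ten -/

theorem intCast_zmod_eq {N : ℕ} {x r : ℤ} (h : x % N = r % N) : (x : ZMod N) = (r : ZMod N) :=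
  (ZMod.intCast_eq_intCast_iff' _ _ _).2 h

/-- A statement about an integer and its class modulo `N`, checked on a set of representatives. -/
theorem forall_zmod {N : ℕ} [NeZero N] {P : ℤ → ZMod N → Prop}
    (h : ∀ r : ℤ, 0 ≤ r → r < N → ∀ x : ℤ, x % N = r → P x r) (x : ℤ) : P x x := by
  have hN : (N : ℤ) ≠ 0 := by exact_mod_cast NeZero.ne N
  have e := h (x % N) (Int.emod_nonneg _ hN)
    (Int.emod_lt_of_pos _ (lt_of_le_of_ne (by positivity) hN.symm)) x rfl
  rwa [← intCast_zmod_eq (N := N) (x := x) (r := x % N) (by simp)] at e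

/-- Euler's product split into residue classes modulo `5`. -/
theorem residueProd_five (ε : ℤ) :
    residueProd 5 1 ε * residueProd 5 4 ε * (residueProd 5 2 ε * residueProd 5 3 ε) *
      residueProd 5 5 ε = residueProd 1 1 ε := by
  rw [← prod_residueProd (s := 1) (k := 5) le_rfl (by norm_num) 1 ε]
  simp only [Finset.prod_range_succ, Finset.prod_range_zero, Nat.reduceMul, Nat.reduceAdd]
  ring

theorem residueProd_two (ε : ℤ) :
    residueProd 2 1 ε * residueProd 2 2 ε = residueProd 1 1 ε := by
  rw [← prod_residueProd (s := 1) (k := 2) le_rfl (by norm_num) 1 ε]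
  simp only [Finset.prod_range_succ, Finset.prod_range_zero]
  norm_num

theorem phiNeg_eq_theta : phiNeg = theta fun x => (-1) ^ x.natAbs := by
  refine HasSum.unique ?_ (hasSum_theta _)
  have h := hasSum_monomial (e := fun x : ℤ => x.natAbs ^ 2) (fun x => (-1 : ℤ) ^ x.natAbs)
    (s := fun n : ℕ => Finset.Icc (-(n : ℤ)) n) ?_
  · convert h using 1
    ext n
    rw [phiNeg, coeff_mk, coeff_mk]
    refine Finset.sum_congr (Finset.filter_congr fun x _ => ?_) fun _ _ => rfl
    rw [← Int.natAbs_sq x]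
    norm_cast
  · intro n x hx
    have : x.natAbs ≤ n := (Nat.le_self_pow two_ne_zero _).trans hx.le
    rw [Finset.mem_Icc]
    omega

theorem phiNeg_mul_eulerAt_two : phiNeg * eulerAt 2 = euler ^ 2 := by
  have h := hasSum_jacobi 2 1 (by norm_num) (ε := -1) (by norm_num)
  have h1 : phiNeg = residueProd 2 1 (-1) * residueProd 2 1 (-1) * eulerAt 2 := by
    rw [phiNeg_eq_theta]
    refine (hasSum_theta _).unique ?_
    refine Eq.mpr (congrArg (HasSum · _) (funext fun n => ?_)) h
    have := two_mul_jacobiExp (s := 2) (a := 1) (by norm_num) n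
    have e : n.natAbs ^ 2 = jacobiExp 2 1 n := by
      zify
      rw [sq_abs]
      push_cast at this
      linarith
    rw [e]
  have h2 := residueProd_two (-1)
  rw [residueProd_self, residueProd_self, eulerAt_one] at h2
  rw [h1, ← h2]
  ring

/-- The theta series `f(-q, -q⁹)`. -/
noncomputable def thetaOneNine : ℤ⟦X⟧ :=
  residueProd 10 1 (-1) * residueProd 10 9 (-1) * eulerAt 10

/-- The theta series `f(-q³, -q⁷)`. -/
noncomputable def thetaThreeSeven : ℤ⟦X⟧ :=
  residueProd 10 3 (-1) * residueProd 10 7 (-1) * eulerAt 10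

theorem thetaOneNine_eq : X ^ 4 * expand 5 (by norm_num) thetaOneNine =
    theta fun x => if (x : ZMod 10) = 3 then -1 else if (x : ZMod 10) = 8 then 1 else 0 := by
  refine X_pow_mul_expand_eq_theta (hasSum_jacobi 10 1 (by norm_num) (ε := -1) (by norm_num))
    (by norm_num) (p := 5) (t := -2) (by norm_num) ?_ ?_ ?_
  · intro n
    have := two_mul_jacobiExp (s := 10) (a := 1) (by norm_num) n
    push_cast at this ⊢
    linarith
  · intro n
    rw [neg_one_pow_natAbs]
    refine forall_zmod (P := fun x z => ∀ n, x = 5 * n + -2 →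
      (if z = 3 then -1 else if z = 8 then 1 else 0 : ℤ) = if n % 2 = 0 then 1 else -1) ?_ _ n rfl
    intro r h1 h2 x hx n hn
    rcases Int.emod_two_eq n with h | h <;> rw [h] <;> interval_cases r <;> first | rfl | omega
  · refine forall_zmod (P := fun x z => ¬ (5 : ℤ) ∣ x - (-2) →
      (if z = 3 then -1 else if z = 8 then 1 else 0 : ℤ) = 0) ?_
    intro r h1 h2 x hx hd
    interval_cases r <;> first | rfl | omega

theorem thetaThreeSeven_eq : X * expand 5 (by norm_num) thetaThreeSeven =
    theta fun x => if (x : ZMod 10) = 9 then 1 else if (x : ZMod 10) = 4 then -1 else 0 := by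
  rw [← pow_one X]
  refine X_pow_mul_expand_eq_theta (hasSum_jacobi 10 3 (by norm_num) (ε := -1) (by norm_num))
    (by norm_num) (p := 5) (t := -1) (by norm_num) ?_ ?_ ?_
  · intro n
    have := two_mul_jacobiExp (s := 10) (a := 3) (by norm_num) n
    push_cast at this ⊢
    linarith
  · intro n
    rw [neg_one_pow_natAbs]
    refine forall_zmod (P := fun x z => ∀ n, x = 5 * n + -1 →
      (if z = 9 then 1 else if z = 4 then -1 else 0 : ℤ) = if n % 2 = 0 then 1 else -1) ?_ _ n rfl
    intro r h1 h2 x hx n hn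
    rcases Int.emod_two_eq n with h | h <;> rw [h] <;> interval_cases r <;> first | rfl | omega
  · refine forall_zmod (P := fun x z => ¬ (5 : ℤ) ∣ x - (-1) →
      (if z = 9 then 1 else if z = 4 then -1 else 0 : ℤ) = 0) ?_
    intro r h1 h2 x hx hd
    interval_cases r <;> first | rfl | omega

/-- The sign `(-1) ^ x` as a function on `ℤ / 10`. -/
def parity (z : ZMod 10) : ℤ := if z.val % 2 = 0 then 1 else -1

theorem phiNeg_eq_theta_parity : phiNeg = theta fun x => parity x := by
  rw [phiNeg_eq_theta]
  congr 1
  funext x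
  rw [neg_one_pow_natAbs]
  refine forall_zmod (P := fun x z => (if x % 2 = 0 then 1 else -1) = parity z) ?_ x
  intro r h1 h2 x hx
  have : x % 2 = r % 2 := by omega
  rw [this]
  interval_cases r <;> rfl

theorem expand_twentyFive_phiNeg : expand 25 (by norm_num) phiNeg =
    theta fun x => if (x : ZMod 10) = 0 ∨ (x : ZMod 10) = 5 then parity x else 0 := by
  rw [phiNeg_eq_theta_parity]
  refine expand_twentyFive_theta ?_ ?_
  · intro x
    push_cast
    generalize (x : ZMod 10) = z
    revert z
    decide
  · refine forall_zmod (P := fun x z => ¬ (5 : ℤ) ∣ x →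
      (if z = 0 ∨ z = 5 then parity z else 0) = 0) ?_
    intro r h1 h2 x hx hd
    interval_cases r <;> first | rfl | omega

theorem zmod_ten_cases (t : ℤ) : ((t : ZMod 10) = 0 ∨ (t : ZMod 10) = 5) → (5 : ℤ) ∣ t := by
  refine forall_zmod (P := fun x z => z = 0 ∨ z = 5 → (5 : ℤ) ∣ x) ?_ t
  intro r h1 h2 x hx
  interval_cases r <;> first | (intro _; omega) | (intro h; exact absurd h (by decide))

theorem expand_five_phiNeg_sq : expand 5 (by norm_num) (phiNeg ^ 2) =
    theta₂ fun x y => if (2 * x - y : ZMod 10) = 0 ∨ (2 * x - y : ZMod 10) = 5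
      then parity x * parity y else 0 := by
  rw [phiNeg_eq_theta_parity, pow_two, theta_mul_theta]
  refine expand_five_theta₂ ?_ ?_
  · intro x y
    push_cast
    generalize (x : ZMod 10) = z
    generalize (y : ZMod 10) = z'
    revert z z'
    decide
  · intro x y hd
    rw [if_neg]
    intro h
    refine hd ?_
    have := zmod_ten_cases (2 * x - y)
    push_cast at this
    exact this h

/-- Ramanujan's identity `φ(-q⁵)² - φ(-q)² = 4 q f(-q, -q⁹) f(-q³, -q⁷)`. After `q ↦ q⁵` all terms
are theta series of `x² + y²` with weights depending on `x, y` modulo `10`, and the weights agree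
after symmetrisation. -/
theorem phiNeg_sq_sub : expand 5 (by norm_num) phiNeg ^ 2 - phiNeg ^ 2 =
    4 * X * (thetaOneNine * thetaThreeSeven) := by
  apply expand_injective (k := 5) (by norm_num)
  have h25 : expand 5 (by norm_num) (expand 5 (by norm_num) phiNeg) =
      expand 25 (by norm_num) phiNeg := (expand_mul (p := 5) _ 5 (by norm_num) phiNeg).symm
  have h1 : expand 5 (by norm_num) (4 * X * (thetaOneNine * thetaThreeSeven)) =
      4 * (X ^ 4 * expand 5 (by norm_num) thetaOneNine *
        (X * expand 5 (by norm_num) thetaThreeSeven)) := by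
    simp only [map_mul, map_ofNat, expand_X]
    ring
  rw [h1, map_sub, map_pow, h25, thetaOneNine_eq, thetaThreeSeven_eq, expand_twentyFive_phiNeg,
    expand_five_phiNeg_sq, pow_two, theta_mul_theta, theta_mul_theta, ← theta₂_sub]
  have := theta₂_const_mul 4 (fun x y =>
    (if (x : ZMod 10) = 3 then -1 else if (x : ZMod 10) = 8 then 1 else 0 : ℤ) *
    (if (y : ZMod 10) = 9 then 1 else if (y : ZMod 10) = 4 then -1 else 0 : ℤ))
  refine Eq.trans ?_ this
  apply theta₂_eq_of_symmSum_eq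
  intro x y
  simp only [symmSum, Int.cast_neg]
  generalize (x : ZMod 10) = z
  generalize (y : ZMod 10) = z'
  revert z z'
  set_option maxRecDepth 100000 in
  decide +kernel

/-- The theta series `ψ(q) = ∑_{n ≥ 0} q ^ (n (n + 1) / 2) = f(q, q³)`. -/
noncomputable def psi : ℤ⟦X⟧ := residueProd 4 1 1 * residueProd 4 3 1 * eulerAt 4

/-- The theta series `f(q, q⁴)`. -/
noncomputable def thetaOneFour : ℤ⟦X⟧ := residueProd 5 1 1 * residueProd 5 4 1 * eulerAt 5

/-- The theta series `f(q², q³)`. -/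
noncomputable def thetaTwoThree : ℤ⟦X⟧ := residueProd 5 2 1 * residueProd 5 3 1 * eulerAt 5

theorem eulerAt_expand (k l : ℕ) [NeZero k] [NeZero l] [NeZero (k * l)] :
    expand k (NeZero.ne k) (eulerAt l) = eulerAt (k * l) :=
  (expand_mul (p := k) (NeZero.ne k) l (NeZero.ne l) euler).symm

theorem psi_mul_euler : psi * euler = eulerAt 2 ^ 2 := by
  have h1 : residueProd 4 1 1 * residueProd 4 3 1 = residueProd 2 1 1 := by
    rw [← prod_residueProd (s := 2) (k := 2) (by norm_num) (by norm_num) 1 1]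
    simp only [Finset.prod_range_succ, Finset.prod_range_zero]
    norm_num
  have h2 := residueProd_two 1
  have h3 := residueProd_one_one_mul_euler
  have h4 := congrArg (expand 2 (by norm_num)) h3
  have e4 : expand 2 (by norm_num) (eulerAt 2) = eulerAt 4 := eulerAt_expand 2 2
  rw [map_mul, expand_residueProd le_rfl, e4] at h4
  have e2 : expand 2 (by norm_num) euler = eulerAt 2 := rfl
  simp only [mul_one, e2] at h4
  rw [psi, h1, ← h4]
  linear_combination (euler * eulerAt 2) * h2 + eulerAt 2 * h3

theorem psi_eq : X * expand 8 (by norm_num) psi =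
    theta fun x => if (x : ZMod 20).val % 4 = 3 then 1 else 0 := by
  rw [← pow_one X]
  refine X_pow_mul_expand_eq_theta (hasSum_jacobi 4 1 (by norm_num) (ε := 1) (by norm_num))
    (by norm_num) (p := 4) (t := -1) (by norm_num) ?_ ?_ ?_
  · intro n
    have := two_mul_jacobiExp (s := 4) (a := 1) (by norm_num) n
    push_cast at this ⊢
    linarith
  · intro n
    rw [one_pow]
    refine forall_zmod (P := fun x z => ∀ n, x = 4 * n + -1 →
      (if z.val % 4 = 3 then 1 else 0 : ℤ) = 1) ?_ _ n rfl
    intro r h1 h2 x hx n hn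
    interval_cases r <;> first | rfl | omega
  · refine forall_zmod (P := fun x z => ¬ (4 : ℤ) ∣ x - (-1) →
      (if z.val % 4 = 3 then 1 else 0 : ℤ) = 0) ?_
    intro r h1 h2 x hx hd
    interval_cases r <;> first | rfl | omega

theorem thetaOneFour_eq : X ^ 9 * expand 40 (by norm_num) thetaOneFour =
    theta fun x => if (x : ZMod 20) = 7 ∨ (x : ZMod 20) = 17 then 1 else 0 := by
  refine X_pow_mul_expand_eq_theta (hasSum_jacobi 5 1 (by norm_num) (ε := 1) (by norm_num))
    (by norm_num) (p := 10) (t := -3) (by norm_num) ?_ ?_ ?_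
  · intro n
    have := two_mul_jacobiExp (s := 5) (a := 1) (by norm_num) n
    push_cast at this ⊢
    linarith
  · intro n
    rw [one_pow]
    refine forall_zmod (P := fun x z => ∀ n, x = 10 * n + -3 →
      (if z = 7 ∨ z = 17 then 1 else 0 : ℤ) = 1) ?_ _ n rfl
    intro r h1 h2 x hx n hn
    interval_cases r <;> first | rfl | omega
  · refine forall_zmod (P := fun x z => ¬ (10 : ℤ) ∣ x - (-3) →
      (if z = 7 ∨ z = 17 then 1 else 0 : ℤ) = 0) ?_
    intro r h1 h2 x hx hd
    interval_cases r <;> first | rfl | omega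

theorem thetaTwoThree_eq : X * expand 40 (by norm_num) thetaTwoThree =
    theta fun x => if (x : ZMod 20) = 9 ∨ (x : ZMod 20) = 19 then 1 else 0 := by
  rw [← pow_one X]
  refine X_pow_mul_expand_eq_theta (hasSum_jacobi 5 2 (by norm_num) (ε := 1) (by norm_num))
    (by norm_num) (p := 10) (t := -1) (by norm_num) ?_ ?_ ?_
  · intro n
    have := two_mul_jacobiExp (s := 5) (a := 2) (by norm_num) n
    push_cast at this ⊢
    linarith
  · intro n
    rw [one_pow]
    refine forall_zmod (P := fun x z => ∀ n, x = 10 * n + -1 →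
      (if z = 9 ∨ z = 19 then 1 else 0 : ℤ) = 1) ?_ _ n rfl
    intro r h1 h2 x hx n hn
    interval_cases r <;> first | rfl | omega
  · refine forall_zmod (P := fun x z => ¬ (10 : ℤ) ∣ x - (-1) →
      (if z = 9 ∨ z = 19 then 1 else 0 : ℤ) = 0) ?_
    intro r h1 h2 x hx hd
    interval_cases r <;> first | rfl | omega

theorem zmod_twenty_cases (t : ℤ) : (t : ZMod 20).val % 5 = 0 → (5 : ℤ) ∣ t := by
  refine forall_zmod (P := fun x z => z.val % 5 = 0 → (5 : ℤ) ∣ x) ?_ t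
  intro r h1 h2 x hx
  interval_cases r <;> first | (intro _; omega) | (intro h; exact absurd h (by decide))

theorem expand_twentyFive_psi : expand 25 (by norm_num) (X * expand 8 (by norm_num) psi) =
    theta fun x => if (x : ZMod 20).val % 5 = 0 ∧ (x : ZMod 20).val % 4 = 3 then 1 else 0 := by
  rw [psi_eq]
  refine expand_twentyFive_theta ?_ ?_
  · intro x
    push_cast
    generalize (x : ZMod 20) = z
    revert z
    decide
  · intro x hx
    rw [if_neg]
    exact fun h => hx (zmod_twenty_cases x h.1)

theorem expand_five_psi_sq : expand 5 (by norm_num) ((X * expand 8 (by norm_num) psi) ^ 2) =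
    theta₂ fun x y => if (2 * x - y : ZMod 20).val % 5 = 0 then
      (if (2 * x - y : ZMod 20).val % 4 = 3 ∧ (x + 2 * y : ZMod 20).val % 4 = 3 then 1 else 0)
      else 0 := by
  rw [psi_eq, pow_two, theta_mul_theta]
  refine expand_five_theta₂ ?_ ?_
  · intro x y
    push_cast
    generalize (x : ZMod 20) = z
    generalize (y : ZMod 20) = z'
    revert z z'
    decide +kernel
  · intro x y hd
    rw [if_neg]
    intro h
    have := zmod_twenty_cases (2 * x - y)
    push_cast at this
    exact hd (this h)

/-- Ramanujan's identity `ψ(q)² - q ψ(q⁵)² = f(q, q⁴) f(q², q³)`. After `q ↦ q⁴⁰` all terms are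
theta series of `x² + y²` with weights depending on `x, y` modulo `20`, and the weights agree after
symmetrisation. -/
theorem psi_sq_sub : psi ^ 2 - X * expand 5 (by norm_num) psi ^ 2 =
    thetaOneFour * thetaTwoThree := by
  apply expand_injective (k := 40) (by norm_num)
  refine mul_left_cancel₀ (pow_ne_zero 10 (X_ne_zero (R := ℤ))) ?_
  have h8 : ∀ f : ℤ⟦X⟧, expand 5 (by norm_num) (expand 8 (by norm_num) f) =
    expand 40 (by norm_num) f := fun f => (expand_mul (p := 5) _ 8 (by norm_num) f).symm
  have h25 : expand 25 (by norm_num) (expand 8 (by norm_num) psi) =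
    expand 40 (by norm_num) (expand 5 (by norm_num) psi) :=
    (expand_mul (p := 25) (by norm_num) 8 (by norm_num) psi).symm.trans
      (expand_mul (p := 40) (by norm_num) 5 (by norm_num) psi)
  have h1 : (X : ℤ⟦X⟧) ^ 10 * expand 40 (by norm_num) (thetaOneFour * thetaTwoThree) =
      (X ^ 9 * expand 40 (by norm_num) thetaOneFour) *
        (X * expand 40 (by norm_num) thetaTwoThree) := by
    simp only [map_mul]
    ring
  have h2 : (X : ℤ⟦X⟧) ^ 10 *
      expand 40 (by norm_num) (psi ^ 2 - X * expand 5 (by norm_num) psi ^ 2) =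
      expand 5 (by norm_num) ((X * expand 8 (by norm_num) psi) ^ 2) -
        (expand 25 (by norm_num) (X * expand 8 (by norm_num) psi)) ^ 2 := by
    simp only [map_mul, map_sub, map_pow, expand_X, h8, h25]
    ring
  rw [h1, h2, thetaOneFour_eq, thetaTwoThree_eq, expand_twentyFive_psi, expand_five_psi_sq,
    pow_two, theta_mul_theta, theta_mul_theta, ← theta₂_sub]
  apply theta₂_eq_of_symmSum_eq
  intro x y
  simp only [symmSum, Int.cast_neg]
  generalize (x : ZMod 20) = z
  generalize (y : ZMod 20) = z'
  revert z z'
  decide +kernel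

/-! ### The Lambert series of `E₁⁵ / E₅` -/

/-- The theta series `f(-q, -q⁴)`. -/
noncomputable def rrTheta₁ : ℤ⟦X⟧ := residueProd 5 1 (-1) * residueProd 5 4 (-1) * eulerAt 5

/-- The theta series `f(-q², -q³)`. -/
noncomputable def rrTheta₂ : ℤ⟦X⟧ := residueProd 5 2 (-1) * residueProd 5 3 (-1) * eulerAt 5

theorem rrTheta₁_mul_rrTheta₂ : rrTheta₁ * rrTheta₂ = euler * eulerAt 5 := by
  have h := residueProd_five (-1)
  rw [residueProd_self, residueProd_self, eulerAt_one] at h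
  rw [rrTheta₁, rrTheta₂]
  linear_combination eulerAt 5 * h

theorem rrTheta₁_eq : X ^ 9 * expand 40 (by norm_num) rrTheta₁ =
    theta fun x => if (x : ZMod 20) = 17 then 1 else if (x : ZMod 20) = 7 then -1 else 0 := by
  refine X_pow_mul_expand_eq_theta (hasSum_jacobi 5 1 (by norm_num) (ε := -1) (by norm_num))
    (by norm_num) (p := 10) (t := -3) (by norm_num) ?_ ?_ ?_
  · intro n
    have := two_mul_jacobiExp (s := 5) (a := 1) (by norm_num) n
    push_cast at this ⊢
    linarith
  · intro n
    rw [neg_one_pow_natAbs]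
    refine forall_zmod (P := fun x z => ∀ n, x = 10 * n + -3 →
      (if z = 17 then 1 else if z = 7 then -1 else 0 : ℤ) = if n % 2 = 0 then 1 else -1)
      ?_ _ n rfl
    intro r h1 h2 x hx n hn
    rcases Int.emod_two_eq n with h | h <;> rw [h] <;> interval_cases r <;> first | rfl | omega
  · refine forall_zmod (P := fun x z => ¬ (10 : ℤ) ∣ x - (-3) →
      (if z = 17 then 1 else if z = 7 then -1 else 0 : ℤ) = 0) ?_
    intro r h1 h2 x hx hd
    interval_cases r <;> first | rfl | omega

theorem rrTheta₂_eq : X * expand 40 (by norm_num) rrTheta₂ =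
    theta fun x => if (x : ZMod 20) = 19 then 1 else if (x : ZMod 20) = 9 then -1 else 0 := by
  rw [← pow_one X]
  refine X_pow_mul_expand_eq_theta (hasSum_jacobi 5 2 (by norm_num) (ε := -1) (by norm_num))
    (by norm_num) (p := 10) (t := -1) (by norm_num) ?_ ?_ ?_
  · intro n
    have := two_mul_jacobiExp (s := 5) (a := 2) (by norm_num) n
    push_cast at this ⊢
    linarith
  · intro n
    rw [neg_one_pow_natAbs]
    refine forall_zmod (P := fun x z => ∀ n, x = 10 * n + -1 →
      (if z = 19 then 1 else if z = 9 then -1 else 0 : ℤ) = if n % 2 = 0 then 1 else -1)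
      ?_ _ n rfl
    intro r h1 h2 x hx n hn
    rcases Int.emod_two_eq n with h | h <;> rw [h] <;> interval_cases r <;> first | rfl | omega
  · refine forall_zmod (P := fun x z => ¬ (10 : ℤ) ∣ x - (-1) →
      (if z = 19 then 1 else if z = 9 then -1 else 0 : ℤ) = 0) ?_
    intro r h1 h2 x hx hd
    interval_cases r <;> first | rfl | omega

/-- The nontrivial character modulo `4`, as a function on `ℤ / 20`. -/
def chiFour (z : ZMod 20) : ℤ := if z.val % 4 = 1 then 1 else if z.val % 4 = 3 then -1 else 0

theorem chiFour_neg (z : ZMod 20) : chiFour (-z) = -chiFour z := by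
  revert z
  decide

theorem theta_add_neg (α : ℤ → ℤ) : theta (fun x => α x + α (-x)) = 2 * theta α := by
  have h1 := (Equiv.neg ℤ).hasSum_iff.2 (hasSum_theta α)
  refine (hasSum_theta _).unique ?_
  convert (hasSum_theta α).add h1 using 2 with x
  · simp
  · ring

theorem two_mul_X_mul_expand_euler_cube : 2 * (X * expand 8 (by norm_num) (euler ^ 3)) =
    theta fun x => chiFour x * x := by
  have h : X ^ 1 * expand 8 (by norm_num) (-euler ^ 3) =
      theta fun x => -chiFour x * ((x + 1) / 2) := by
    refine X_pow_mul_expand_eq_theta hasSum_jacobi_cube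
      (by norm_num) (p := 2) (t := -1) (by norm_num) ?_ ?_ ?_
    · intro n
      have := two_mul_jacobiExp (s := 1) (a := 0) (by norm_num) n
      push_cast at this ⊢
      linarith
    · intro n
      have e : (2 * n + -1 + 1) / 2 = n := by omega
      rw [neg_one_pow_natAbs, e]
      congr 1
      refine forall_zmod (P := fun x z => ∀ n, x = 2 * n + -1 →
        -chiFour z = if n % 2 = 0 then 1 else -1) ?_ _ n rfl
      intro r h1 h2 x hx n hn
      rcases Int.emod_two_eq n with h | h <;> rw [h] <;> interval_cases r <;> first | rfl | omega
    · refine forall_zmod (P := fun x z => ¬ (2 : ℤ) ∣ x - (-1) →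
        -chiFour z * ((x + 1) / 2) = 0) ?_
      intro r h1 h2 x hx hd
      have : chiFour r = 0 := by interval_cases r <;> first | rfl | omega
      rw [this]
      simp
  have h2 := theta_add_neg fun x => -chiFour x * ((x + 1) / 2)
  rw [← h] at h2
  have h3 : (fun x : ℤ => -chiFour (x : ZMod 20) * ((x + 1) / 2) +
      -chiFour ((-x : ℤ) : ZMod 20) * ((-x + 1) / 2)) =
      fun x : ℤ => -(chiFour (x : ZMod 20) * x) := by
    funext x
    rw [Int.cast_neg, chiFour_neg]
    rcases Int.emod_two_eq x with h | h
    · have : chiFour x = 0 := by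
        refine forall_zmod (P := fun x z => x % 2 = 0 → chiFour z = 0) ?_ x h
        intro r h1 h2 x hx h
        interval_cases r <;> first | rfl | omega
      rw [this]
      ring
    · obtain ⟨m, rfl⟩ : ∃ m, x = 2 * m + 1 := ⟨x / 2, by omega⟩
      have e1 : (2 * m + 1 + 1) / 2 = m + 1 := by omega
      have e2 : (-(2 * m + 1) + 1) / 2 = -m := by omega
      rw [e1, e2]
      ring
  rw [h3] at h2
  have h4 : theta (fun x : ℤ => -(chiFour (x : ZMod 20) * x)) =
      -theta fun x : ℤ => chiFour (x : ZMod 20) * x := by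
    refine (hasSum_theta _).unique ?_
    simpa only [map_neg] using (hasSum_theta fun x : ℤ => chiFour (x : ZMod 20) * x).neg
  rw [h4, map_neg] at h2
  linear_combination h2

/-- The weight `χ₄(u) χ₄(v)` in the coordinates `x = 2 u + v`, `y = 2 v - u`, extended by zero
outside the lattice of these points; note `5 u = 2 x - y`, `5 v = x + 2 y` and `χ₄(5) = 1`. -/
def rotatedChi (z w : ZMod 20) : ℤ :=
  if (2 * z - w).val % 5 = 0 then chiFour (2 * z - w) * chiFour (z + 2 * w) else 0

/-- The sixth power of Euler's product, from Jacobi's identity for its cube, as a theta series of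
`x² + y²` with a harmonic weight. -/
theorem expand_five_euler_pow_six :
    32 * (X ^ 10 * expand 40 (by norm_num) (euler ^ 6)) =
    theta₂ fun x y => rotatedChi x y * (x ^ 2 - y ^ 2) := by
  have h40 : ∀ f : ℤ⟦X⟧, expand 5 (by norm_num) (expand 8 (by norm_num) f) =
    expand 40 (by norm_num) f := fun f => (expand_mul (p := 5) _ 8 (by norm_num) f).symm
  have h1 : 32 * (X ^ 10 * expand 40 (by norm_num) (euler ^ 6)) =
      expand 5 (by norm_num) (8 * ((2 * (X * expand 8 (by norm_num) (euler ^ 3))) *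
        (2 * (X * expand 8 (by norm_num) (euler ^ 3))))) := by
    simp only [map_mul, map_pow, map_ofNat, expand_X, h40]
    ring
  have h2 := theta₂_const_mul 8 fun x y => chiFour x * x * (chiFour y * y)
  push_cast at h2
  rw [h1, two_mul_X_mul_expand_euler_cube, theta_mul_theta, ← h2]
  -- Adding the antisymmetric weight `3 (u² - v²)` makes the weight equal to `x² - y²`.
  have h3 : theta₂ (fun x y => 8 * (chiFour x * x * (chiFour y * y))) =
      theta₂ fun x y => chiFour x * chiFour y * (3 * x ^ 2 - 3 * y ^ 2 + 8 * x * y) := by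
    apply theta₂_eq_of_symmSum_eq
    intro x y
    simp only [symmSum, Int.cast_neg, chiFour_neg]
    ring
  rw [h3]
  refine expand_five_theta₂ ?_ ?_
  · intro u v
    have e1 : (2 * ((2 * u + v : ℤ) : ZMod 20) - ((2 * v - u : ℤ) : ZMod 20)) = 5 * u := by
      push_cast; ring
    have e2 : (((2 * u + v : ℤ) : ZMod 20) + 2 * ((2 * v - u : ℤ) : ZMod 20)) = 5 * v := by
      push_cast; ring
    have e3 : ∀ z : ZMod 20, chiFour (5 * z) = chiFour z := by decide
    have e4 : ∀ z : ZMod 20, (5 * z).val % 5 = 0 := by decide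
    rw [rotatedChi, e1, e2, e3, e3, if_pos (e4 _)]
    ring
  · intro x y hd
    rw [rotatedChi, if_neg, zero_mul]
    intro h
    have := zmod_twenty_cases (2 * x - y)
    push_cast at this
    exact hd (this h)

/-- The sixth power of Euler's product in terms of the Wronskian of the two Rogers-Ramanujan theta
series: both sides are theta series of `x² + y²` with weight `x² - y²` times a function of `x, y`
modulo `20`. -/
theorem wronskian_rrTheta :
    euler ^ 6 = rrTheta₁ * rrTheta₂ +
      5 * (eulerD rrTheta₁ * rrTheta₂ - rrTheta₁ * eulerD rrTheta₂) := by
  have h1 := expand_five_euler_pow_six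
  have h2 : X ^ 10 * expand 40 (by norm_num) (8 * (rrTheta₁ * rrTheta₂) +
      40 * (eulerD rrTheta₁ * rrTheta₂ - rrTheta₁ * eulerD rrTheta₂)) =
      eulerD (X ^ 9 * expand 40 (by norm_num) rrTheta₁) * (X * expand 40 (by norm_num) rrTheta₂) -
      (X ^ 9 * expand 40 (by norm_num) rrTheta₁) *
        eulerD (X * expand 40 (by norm_num) rrTheta₂) := by
    have hX : eulerD (X : ℤ⟦X⟧) = X := by simpa using eulerD_X_pow 1
    simp only [eulerD_mul, eulerD_X_pow, eulerD_expand, hX, map_add, map_sub, map_mul, map_ofNat]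
    push_cast
    ring
  rw [rrTheta₁_eq, rrTheta₂_eq, eulerD_theta, eulerD_theta, theta_mul_theta, theta_mul_theta,
    ← theta₂_sub] at h2
  have h3 : (32 : ℤ⟦X⟧) * (X ^ 10 * expand 40 (by norm_num) (euler ^ 6)) =
      4 * (X ^ 10 * expand 40 (by norm_num) (8 * (rrTheta₁ * rrTheta₂) +
      40 * (eulerD rrTheta₁ * rrTheta₂ - rrTheta₁ * eulerD rrTheta₂))) := by
    have h4 := theta₂_const_mul 4 fun x y =>
      x ^ 2 * (if (x : ZMod 20) = 17 then 1 else if (x : ZMod 20) = 7 then -1 else 0 : ℤ) *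
        (if (y : ZMod 20) = 19 then 1 else if (y : ZMod 20) = 9 then -1 else 0 : ℤ) -
      (if (x : ZMod 20) = 17 then 1 else if (x : ZMod 20) = 7 then -1 else 0 : ℤ) *
        (y ^ 2 * (if (y : ZMod 20) = 19 then 1 else if (y : ZMod 20) = 9 then -1 else 0 : ℤ))
    push_cast at h4
    rw [h1, h2, ← h4]
    apply theta₂_eq_of_symmSum_eq
    intro x y
    have key : ∀ z w : ZMod 20,
        let G : ZMod 20 → ZMod 20 → ℤ := fun z w =>
          (if z = 17 then 1 else if z = 7 then -1 else 0) *
          (if w = 19 then 1 else if w = 9 then -1 else 0)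
        rotatedChi z w + rotatedChi (-z) w + (rotatedChi z (-w) + rotatedChi (-z) (-w)) -
          (rotatedChi w z + rotatedChi (-w) z +
            (rotatedChi w (-z) + rotatedChi (-w) (-z))) =
        4 * (G z w + G (-z) w + (G z (-w) + G (-z) (-w)) -
          (G w z + G (-w) z + (G w (-z) + G (-w) (-z)))) := by
      decide +kernel
    have k := key x y
    simp only at k
    simp only [symmSum, Int.cast_neg]
    linear_combination (x ^ 2 - y ^ 2) * k
  have h5 : expand 40 (by norm_num) (euler ^ 6) = expand 40 (by norm_num) (rrTheta₁ * rrTheta₂ +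
      5 * (eulerD rrTheta₁ * rrTheta₂ - rrTheta₁ * eulerD rrTheta₂)) := by
    refine mul_left_cancel₀ (pow_ne_zero 10 (X_ne_zero (R := ℤ))) ?_
    have h32 : (32 : ℤ⟦X⟧) ≠ 0 := by
      have : (32 : ℤ⟦X⟧) = C 32 := by simp
      rw [this, Ne, map_eq_zero_iff _ C_injective]
      norm_num
    refine mul_left_cancel₀ h32 ?_
    rw [h3]
    simp only [map_add, map_mul, map_ofNat]
    ring
  exact expand_injective (by norm_num) h5

/-- The Lambert term `d q ^ d / (1 - q ^ d)`. -/
noncomputable def lambertTerm (d : ℕ) : ℤ⟦X⟧ :=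
  PowerSeries.mk fun N => if N ≠ 0 ∧ d ∣ N then (d : ℤ) else 0

theorem one_sub_X_pow_mul_lambertTerm {d : ℕ} (hd : d ≠ 0) :
    (1 - (X : ℤ⟦X⟧) ^ d) * lambertTerm d = (d : ℤ⟦X⟧) * (X : ℤ⟦X⟧) ^ d := by
  ext N
  rw [sub_mul, one_mul, map_sub, coeff_X_pow_mul', ← map_natCast (C (R := ℤ)), coeff_C_mul,
    coeff_X_pow, lambertTerm]
  simp only [coeff_mk]
  rcases lt_trichotomy N d with h | h | h
  · have h1 : ¬ (N ≠ 0 ∧ d ∣ N) := fun h2 =>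
      absurd (Nat.le_of_dvd (Nat.pos_of_ne_zero h2.1) h2.2) (by omega)
    rw [if_neg h1, if_neg (by omega), if_neg (by omega)]
    simp
  · subst h
    simp [hd]
  · rw [if_pos h.le]
    have : d ∣ N - d ↔ d ∣ N := Nat.dvd_sub_self_right.trans (by
      constructor
      · rintro (h' | h')
        · exact h'
        · omega
      · exact Or.inl)
    have h1 : N ≠ 0 := by omega
    have h2 : N - d ≠ 0 := by omega
    simp only [this, h1, h2, h.ne', ne_eq, not_false_eq_true, true_and, if_false, mul_zero,
      sub_self]

/-- `∑_{d ∣ N, d ≡ a (mod s)} d`, as a power series in `N`; this is minus the logarithmic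
derivative of `∏_{j ≥ 0} (1 - q ^ (s j + a))`. -/
noncomputable def divisorSeries (s a : ℕ) : ℤ⟦X⟧ :=
  PowerSeries.mk fun N => ∑ d ∈ N.divisors, if d % s = a then (d : ℤ) else 0

theorem tendsto_sum_lambertTerm {s a : ℕ} (ha : 1 ≤ a) (has : a < s) :
    Tendsto (fun M => ∑ j ∈ Finset.range M, lambertTerm (s * j + a)) atTop
      (𝓝 (divisorSeries s a)) := by
  rw [tendsto_iff_eventually_coeff]
  intro N
  filter_upwards [eventually_gt_atTop N] with M hM
  rw [map_sum, divisorSeries, coeff_mk, ← Finset.sum_filter]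
  simp only [lambertTerm, coeff_mk]
  rw [← Finset.sum_filter]
  refine Finset.sum_nbij' (fun j => s * j + a) (fun d => d / s) ?_ ?_ ?_ ?_ ?_
  · intro j hj
    simp only [Finset.mem_filter, Finset.mem_range, Nat.mem_divisors] at hj ⊢
    exact ⟨⟨hj.2.2, hj.2.1⟩, by rw [Nat.mul_add_mod, Nat.mod_eq_of_lt has]⟩
  · intro d hd
    simp only [Finset.mem_filter, Finset.mem_range, Nat.mem_divisors] at hd ⊢
    have e : s * (d / s) + a = d := by rw [← hd.2]; exact Nat.div_add_mod d s
    refine ⟨?_, hd.1.2, e.symm ▸ hd.1.1⟩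
    exact lt_of_le_of_lt ((Nat.div_le_self d s).trans
      (Nat.le_of_dvd (Nat.pos_of_ne_zero hd.1.2) hd.1.1)) hM
  · intro j _
    rw [Nat.mul_add_div (by omega), Nat.div_eq_of_lt has, add_zero]
  · intro d hd
    simp only [Finset.mem_filter] at hd ⊢
    rw [← hd.2]
    exact Nat.div_add_mod d s
  · intro j _
    rfl

theorem eulerD_residueProd {s a : ℕ} (ha : 1 ≤ a) (has : a < s) :
    eulerD (residueProd s a (-1)) = -(residueProd s a (-1) * divisorSeries s a) := by
  have h1 := (hasProd_residueProd (by omega : 1 ≤ s) a (-1)).tendsto_prod_nat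
  have h2 := (h1.mul (tendsto_sum_lambertTerm ha has)).neg
  refine tendsto_nhds_unique (tendsto_eulerD h1) (h2.congr fun M => ?_)
  have hterm : ∀ d : ℕ, (1 + monomial d (-1) : ℤ⟦X⟧) = 1 - X ^ d := fun d => by
    rw [monomial_eq_C_mul_X_pow]; simp [sub_eq_add_neg]
  simp only [hterm]
  induction M with
  | zero =>
    ext n
    simp only [Finset.range_zero, Finset.prod_empty, Finset.sum_empty, mul_zero, neg_zero, map_zero,
      coeff_eulerD, coeff_one]
    split_ifs with hn <;> simp [hn]
  | succ M ih =>
    have hsub : eulerD (1 - (X : ℤ⟦X⟧) ^ (s * M + a)) =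
        -(((s * M + a : ℕ) : ℤ⟦X⟧) * (X : ℤ⟦X⟧) ^ (s * M + a)) := by
      rw [← eulerD_X_pow]
      ext n
      simp only [map_neg, coeff_eulerD, map_sub, coeff_one, mul_sub]
      split_ifs with hn <;> simp [hn]
    have h3 := one_sub_X_pow_mul_lambertTerm (d := s * M + a) (by omega)
    rw [Finset.prod_range_succ, Finset.sum_range_succ, eulerD_mul, ← ih, hsub, ← h3]
    ring

/-- The nontrivial quadratic character modulo `5`, as a function on `ℕ`. -/
def chiFive (d : ℕ) : ℤ :=
  if d % 5 = 1 ∨ d % 5 = 4 then 1 else if d % 5 = 2 ∨ d % 5 = 3 then -1 else 0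

/-- The twisted divisor sum `∑_{d ∣ n} χ₅(d) d`. -/
def sigmaChi (n : ℕ) : ℤ := ∑ d ∈ n.divisors, chiFive d * d

/-- The Lambert series `1 - 5 ∑_{n ≥ 1} χ₅(n) n q ^ n / (1 - q ^ n)`. -/
noncomputable def lambert : ℤ⟦X⟧ := 1 - 5 * PowerSeries.mk sigmaChi

/-- The Wronskian of the two theta series, by logarithmic differentiation of their products. -/
theorem eulerD_rrTheta :
    eulerD rrTheta₁ * rrTheta₂ - rrTheta₁ * eulerD rrTheta₂ =
      -(rrTheta₁ * rrTheta₂ * PowerSeries.mk sigmaChi) := by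
  have e : PowerSeries.mk sigmaChi = divisorSeries 5 1 + divisorSeries 5 4 -
      (divisorSeries 5 2 + divisorSeries 5 3) := by
    ext N
    simp only [map_add, map_sub, divisorSeries, coeff_mk, sigmaChi]
    rw [← Finset.sum_add_distrib, ← Finset.sum_add_distrib, ← Finset.sum_sub_distrib]
    refine Finset.sum_congr rfl fun d _ => ?_
    have : d % 5 < 5 := Nat.mod_lt _ (by norm_num)
    rw [chiFive]
    interval_cases d % 5 <;> simp
  rw [e, rrTheta₁, rrTheta₂]
  simp only [eulerD_mul, eulerD_residueProd (s := 5) (a := 1) (by norm_num) (by norm_num),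
    eulerD_residueProd (s := 5) (a := 2) (by norm_num) (by norm_num),
    eulerD_residueProd (s := 5) (a := 3) (by norm_num) (by norm_num),
    eulerD_residueProd (s := 5) (a := 4) (by norm_num) (by norm_num)]
  ring

/-- Ramanujan's identity `E₁⁵ / E₅ = 1 - 5 ∑ χ₅(n) n q ^ n / (1 - q ^ n)`. -/
theorem euler_pow_five : euler ^ 5 = eulerAt 5 * lambert := by
  have h := wronskian_rrTheta
  rw [eulerD_rrTheta, rrTheta₁_mul_rrTheta₂] at h
  refine mul_left_cancel₀ euler_ne_zero ?_
  rw [lambert]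
  linear_combination h

/-! ### Twisted divisor sums -/

theorem chiFive_mul (m n : ℕ) : chiFive (m * n) = chiFive m * chiFive n := by
  have h1 : m % 5 < 5 := Nat.mod_lt _ (by norm_num)
  have h2 : n % 5 < 5 := Nat.mod_lt _ (by norm_num)
  simp only [chiFive, Nat.mul_mod m n]
  generalize m % 5 = a at *
  generalize n % 5 = b at *
  interval_cases a <;> interval_cases b <;> rfl

theorem sigmaChi_five_mul (n : ℕ) : sigmaChi (5 * n) = sigmaChi n := by
  rcases Nat.eq_zero_or_pos n with rfl | hn
  · rfl
  refine (Finset.sum_subset (Nat.divisors_subset_of_dvd (by omega) (Dvd.intro_left 5 rfl))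
    fun d hd hd' => ?_).symm
  have h5 : d % 5 = 0 := by
    by_contra h
    have hc : Nat.Coprime d 5 := by
      rw [Nat.coprime_comm, Nat.Prime.coprime_iff_not_dvd (by norm_num)]
      omega
    exact hd' (Nat.mem_divisors.2 ⟨hc.dvd_of_dvd_mul_left (Nat.dvd_of_mem_divisors hd), hn.ne'⟩)
  simp [chiFive, h5]

theorem sigmaChi_two_mul {n : ℕ} (hn : n % 2 = 1) : sigmaChi (2 * n) = -sigmaChi n := by
  have hd : (2 * n).divisors = n.divisors ∪ n.divisors.image (2 * ·) := by
    ext d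
    simp only [Nat.mem_divisors, Finset.mem_union, Finset.mem_image]
    constructor
    · rintro ⟨h, h0⟩
      rcases Nat.even_or_odd' d with ⟨k, rfl | rfl⟩
      · exact Or.inr ⟨k, ⟨Nat.dvd_of_mul_dvd_mul_left (by norm_num) h, by omega⟩, rfl⟩
      · refine Or.inl ⟨Nat.Coprime.dvd_of_dvd_mul_left ?_ h, by omega⟩
        simp
    · rintro (⟨h, h0⟩ | ⟨k, ⟨h, h0⟩, rfl⟩)
      · exact ⟨h.mul_left 2, by omega⟩
      · exact ⟨Nat.mul_dvd_mul_left 2 h, by omega⟩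
  have hdisj : Disjoint n.divisors (n.divisors.image (2 * ·)) := by
    rw [Finset.disjoint_left]
    intro d hd hd'
    obtain ⟨k, -, rfl⟩ := Finset.mem_image.1 hd'
    have := (Dvd.intro k rfl : 2 ∣ 2 * k).trans (Nat.dvd_of_mem_divisors hd)
    omega
  rw [sigmaChi, hd, Finset.sum_union hdisj, Finset.sum_image fun a _ b _ h => by simpa using h]
  have h2 : ∑ d ∈ n.divisors, chiFive (2 * d) * ((2 * d : ℕ) : ℤ) = -2 * sigmaChi n := by
    rw [sigmaChi, Finset.mul_sum]
    refine Finset.sum_congr rfl fun d _ => ?_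
    rw [chiFive_mul, show chiFive 2 = -1 from rfl]
    push_cast
    ring
  rw [h2, sigmaChi]
  ring

/-! ### Five-dissections -/

/-- The part of a power series supported on the exponents `≡ r (mod 5)`. -/
noncomputable def resPart (r : ZMod 5) (f : ℤ⟦X⟧) : ℤ⟦X⟧ :=
  PowerSeries.mk fun n => if (n : ZMod 5) = r then coeff n f else 0

/-- The power series `f` is supported on the exponents `≡ r (mod 5)`. -/
def IsRes (r : ZMod 5) (f : ℤ⟦X⟧) : Prop := ∀ n : ℕ, (n : ZMod 5) ≠ r → coeff n f = 0

theorem coeff_resPart (r : ZMod 5) (f : ℤ⟦X⟧) (n : ℕ) :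
    coeff n (resPart r f) = if (n : ZMod 5) = r then coeff n f else 0 := by
  rw [resPart, coeff_mk]

theorem isRes_resPart (r : ZMod 5) (f : ℤ⟦X⟧) : IsRes r (resPart r f) := fun n hn => by
  rw [coeff_resPart, if_neg hn]

theorem IsRes.mul {r s : ZMod 5} {f g : ℤ⟦X⟧} (hf : IsRes r f) (hg : IsRes s g) :
    IsRes (r + s) (f * g) := fun n hn => by
  rw [coeff_mul]
  refine Finset.sum_eq_zero fun p hp => ?_
  rcases eq_or_ne (p.1 : ZMod 5) r with h1 | h1
  · rcases eq_or_ne (p.2 : ZMod 5) s with h2 | h2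
    · refine absurd ?_ hn
      rw [← h1, ← h2, ← Finset.HasAntidiagonal.mem_antidiagonal.1 hp]
      push_cast
      rfl
    · rw [hg _ h2, mul_zero]
  · rw [hf _ h1, zero_mul]

theorem IsRes.add {r : ZMod 5} {f g : ℤ⟦X⟧} (hf : IsRes r f) (hg : IsRes r g) :
    IsRes r (f + g) := fun n hn => by rw [map_add, hf n hn, hg n hn, add_zero]

theorem isRes_intCast (k : ℤ) : IsRes 0 (k : ℤ⟦X⟧) := fun n hn => by
  have h : n ≠ 0 := by rintro rfl; simp at hn
  rw [← map_intCast (C (R := ℤ)), coeff_C, if_neg h]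

theorem IsRes.pow {r : ZMod 5} {f : ℤ⟦X⟧} (hf : IsRes r f) (k : ℕ) : IsRes (k * r) (f ^ k) := by
  induction k with
  | zero => simpa using isRes_intCast 1
  | succ k ih =>
    rw [pow_succ]
    have := ih.mul hf
    convert this using 1
    push_cast
    ring

theorem isRes_expand (f : ℤ⟦X⟧) : IsRes 0 (expand 5 (by norm_num) f) := fun n hn => by
  refine coeff_expand_of_not_dvd 5 _ _ fun h => hn ?_
  exact (ZMod.natCast_eq_zero_iff n 5).2 h

theorem resPart_mul {r : ZMod 5} {e f : ℤ⟦X⟧} (he : IsRes 0 e) :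
    resPart r (e * f) = e * resPart r f := by
  ext n
  rw [coeff_resPart, coeff_mul, coeff_mul]
  split_ifs with h
  · refine Finset.sum_congr rfl fun p hp => ?_
    rw [coeff_resPart]
    split_ifs with h2
    · rfl
    · rw [mul_zero, he p.1, zero_mul]
      intro h3
      refine h2 ?_
      rw [← h, ← Finset.HasAntidiagonal.mem_antidiagonal.1 hp]
      push_cast
      rw [h3, zero_add]
  · refine (Finset.sum_eq_zero fun p hp => ?_).symm
    rw [coeff_resPart]
    split_ifs with h2
    · rw [he, zero_mul]
      intro h3
      refine h ?_
      rw [← h2, ← Finset.HasAntidiagonal.mem_antidiagonal.1 hp]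
      push_cast
      rw [h3, zero_add]
    · rw [mul_zero]

theorem resPart_sum {p : ZMod 5 → ℤ⟦X⟧} (hp : ∀ i, IsRes i (p i)) (r : ZMod 5) :
    resPart r (∑ i, p i) = p r := by
  ext n
  rw [coeff_resPart]
  split_ifs with h
  · rw [map_sum, Finset.sum_eq_single r (fun i _ hi => hp i n (h ▸ hi.symm)) (by simp)]
  · exact (hp r n h).symm

/-- The five-dissection of a power series written as a sum of its parts. -/
theorem resPart_of_eq_sum {f p0 p1 p2 p3 p4 : ℤ⟦X⟧} (h0 : IsRes 0 p0) (h1 : IsRes 1 p1)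
    (h2 : IsRes 2 p2) (h3 : IsRes 3 p3) (h4 : IsRes 4 p4) (h : f = p0 + p1 + p2 + p3 + p4) :
    resPart 0 f = p0 ∧ resPart 1 f = p1 ∧ resPart 2 f = p2 ∧ resPart 3 f = p3 ∧
      resPart 4 f = p4 := by
  let p : ZMod 5 → ℤ⟦X⟧ := fun i => (![p0, p1, p2, p3, p4] : Fin 5 → ℤ⟦X⟧) i
  have hp : ∀ i : ZMod 5, IsRes i (p i) := by
    intro i
    match i with
    | 0 => exact h0
    | 1 => exact h1
    | 2 => exact h2
    | 3 => exact h3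
    | 4 => exact h4
  have hf : f = ∑ i, p i := by
    rw [h]
    exact (Fin.sum_univ_five (![p0, p1, p2, p3, p4] : Fin 5 → ℤ⟦X⟧)).symm
  rw [hf]
  exact ⟨resPart_sum hp 0, resPart_sum hp 1, resPart_sum hp 2, resPart_sum hp 3, resPart_sum hp 4⟩

theorem HasSum.resPart_monomial {ι : Type*} {e : ι → ℕ} {a : ι → ℤ} {f : ℤ⟦X⟧}
    (hf : HasSum (fun i => monomial (e i) (a i)) f) (r : ZMod 5) :
    HasSum (fun i => if (e i : ZMod 5) = r then monomial (e i) (a i) else 0) (resPart r f) := by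
  rw [hasSum_iff_hasSum_coeff] at hf ⊢
  intro d
  rw [coeff_resPart]
  split_ifs with h
  · refine Eq.mpr (congrArg (HasSum · _) (funext fun i => ?_)) (hf d)
    split_ifs with h2
    · rfl
    · rw [map_zero, coeff_monomial, if_neg]
      rintro rfl
      exact h2 h
  · refine Eq.mpr (congrArg (HasSum · _) (funext fun i => ?_)) hasSum_zero
    split_ifs with h2
    · rw [coeff_monomial, if_neg]
      rintro rfl
      exact h h2
    · rw [map_zero]

/-- The **pentagonal number theorem**. -/
theorem hasSum_pentagonal :
    HasSum (fun n : ℤ => monomial (jacobiExp 3 1 n) ((-1) ^ n.natAbs)) euler := by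
  have h := hasSum_jacobi 3 1 (by norm_num) (ε := -1) (by norm_num)
  have h2 := prod_residueProd (s := 1) (k := 3) le_rfl (by norm_num) 1 (-1)
  simp only [Finset.prod_range_succ, Finset.prod_range_zero, Nat.reduceMul, Nat.reduceAdd,
    one_mul] at h2
  rw [residueProd_self, residueProd_self, eulerAt_one] at h2
  rwa [← h2]

theorem jacobiExp_three_zmod (n : ℤ) :
    (jacobiExp 3 1 n : ZMod 5) = 3 * (3 * (n : ZMod 5) ^ 2 - n) := by
  have h := congrArg (Int.cast : ℤ → ZMod 5) (two_mul_jacobiExp (s := 3) (a := 1) (by norm_num) n)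
  push_cast at h
  have h6 : (6 : ZMod 5) = 1 := rfl
  linear_combination 3 * h - (jacobiExp 3 1 n : ZMod 5) * h6

theorem jacobiExp_one_zmod (n : ℤ) :
    (jacobiExp 1 0 n : ZMod 5) = 3 * ((n : ZMod 5) ^ 2 - n) := by
  have h := congrArg (Int.cast : ℤ → ZMod 5) (two_mul_jacobiExp (s := 1) (a := 0) (by norm_num) n)
  push_cast at h
  have h6 : (6 : ZMod 5) = 1 := rfl
  linear_combination 3 * h - (jacobiExp 1 0 n : ZMod 5) * h6

theorem resPart_euler_eq_zero {r : ZMod 5} (hr : r = 3 ∨ r = 4) : resPart r euler = 0 := by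
  refine (HasSum.resPart_monomial hasSum_pentagonal r).unique ?_
  refine Eq.mpr (congrArg (HasSum · _) (funext fun n => ?_)) hasSum_zero
  rw [if_neg]
  rw [jacobiExp_three_zmod]
  generalize (n : ZMod 5) = z
  revert r z
  decide

/-- The exponents `n (n - 1) / 2` in Jacobi's series for `E³` are never `≡ 2 (mod 5)`. -/
theorem resPart_two_euler_cube : resPart 2 (euler ^ 3) = 0 := by
  have h : resPart 2 (-euler ^ 3) = 0 := by
    refine (HasSum.resPart_monomial hasSum_jacobi_cube 2).unique ?_
    refine Eq.mpr (congrArg (HasSum · _) (funext fun n => ?_)) hasSum_zero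
    rw [if_neg]
    rw [jacobiExp_one_zmod]
    generalize (n : ZMod 5) = z
    revert z
    decide
  ext n
  have := congrArg (coeff n) h
  rw [coeff_resPart] at this ⊢
  simpa using this

/-- The exponents `n (3 n - 1) / 2 ≡ 1 (mod 5)` come from `n = 1 - 5 k`, where they are
`1 + 25 k (3 k - 1) / 2`. -/
theorem resPart_one_euler : resPart 1 euler = -(X * eulerAt 25) := by
  refine (HasSum.resPart_monomial hasSum_pentagonal 1).unique ?_
  have hinj : Function.Injective fun k : ℤ => 1 - 5 * k := fun a b hab => by
    simp only at hab
    omega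
  refine (hinj.hasSum_iff ?_).1 ?_
  · intro n hn
    rw [if_neg]
    intro h
    rw [jacobiExp_three_zmod] at h
    have h1 : (n : ZMod 5) = ((1 : ℤ) : ZMod 5) := by
      generalize (n : ZMod 5) = z at h ⊢
      revert z
      decide
    have := (ZMod.intCast_eq_intCast_iff' _ _ _).1 h1
    refine hn ⟨(1 - n) / 5, ?_⟩
    simp only
    push_cast at this
    omega
  · have h := (HasSum.X_pow_mul_monomial (HasSum.expand_monomial hasSum_pentagonal
      (k := 25) (by norm_num)) 1).neg
    rw [pow_one] at h
    refine Eq.mpr (congrArg (HasSum · _) (funext fun k => ?_)) h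
    have e : jacobiExp 3 1 (1 - 5 * k) = 1 + 25 * jacobiExp 3 1 k := by
      have h1 := two_mul_jacobiExp (s := 3) (a := 1) (by norm_num) k
      have h2 := two_mul_jacobiExp (s := 3) (a := 1) (by norm_num) (1 - 5 * k)
      zify
      push_cast at h1 h2
      linarith
    rw [Function.comp_apply, e, if_pos, ← map_neg]
    · congr 1
      rw [neg_one_pow_natAbs, neg_one_pow_natAbs]
      split_ifs <;> first | rfl | omega
    · push_cast
      have : (25 : ZMod 5) = 0 := rfl
      rw [this]
      ring

theorem isRes_mul_pow {s u t : ℤ⟦X⟧} (hs : IsRes 0 s) (hu : IsRes 1 u) (ht : IsRes 2 t) (k : ℤ)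
    (a b c : ℕ) {r : ZMod 5} (hr : ((b + 2 * c : ℕ) : ZMod 5) = r) :
    IsRes r ((k : ℤ⟦X⟧) * (s ^ a * u ^ b * t ^ c)) := by
  have h := (isRes_intCast k).mul (((hs.pow a).mul (hu.pow b)).mul (ht.pow c))
  convert h using 1
  rw [← hr]
  push_cast
  ring

/-- Ramanujan's five-dissection of Euler's product: `E = s + u + t` with `u = -q E(q²⁵)` and
`s t = -u²`. The last relation holds because the exponents `n (n - 1) / 2` of `E³` are never
`≡ 2 (mod 5)`. -/
theorem exists_euler_dissection : ∃ s u t : ℤ⟦X⟧, IsRes 0 s ∧ IsRes 1 u ∧ IsRes 2 t ∧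
    euler = s + u + t ∧ u = -(X * eulerAt 25) ∧ s * t + u ^ 2 = 0 := by
  obtain ⟨s, hs⟩ : ∃ s, s = resPart 0 euler := ⟨_, rfl⟩
  obtain ⟨u, hu⟩ : ∃ u, u = resPart 1 euler := ⟨_, rfl⟩
  obtain ⟨t, ht⟩ : ∃ t, t = resPart 2 euler := ⟨_, rfl⟩
  have hE : euler = s + u + t := by
    ext n
    rw [map_add, map_add, hs, hu, ht, coeff_resPart, coeff_resPart, coeff_resPart]
    have h3 := congrArg (coeff n) (resPart_euler_eq_zero (r := 3) (Or.inl rfl))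
    have h4 := congrArg (coeff n) (resPart_euler_eq_zero (r := 4) (Or.inr rfl))
    rw [coeff_resPart, map_zero] at h3 h4
    have hz : ∀ z : ZMod 5, z = 0 ∨ z = 1 ∨ z = 2 ∨ z = 3 ∨ z = 4 := by decide
    generalize (n : ZMod 5) = z at *
    rcases hz z with rfl | rfl | rfl | rfl | rfl
    · rw [if_pos rfl, if_neg (by decide), if_neg (by decide)]; ring
    · rw [if_neg (by decide), if_pos rfl, if_neg (by decide)]; ring
    · rw [if_neg (by decide), if_neg (by decide), if_pos rfl]; ring
    · rw [if_neg (by decide), if_neg (by decide), if_neg (by decide)]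
      rw [if_pos rfl] at h3
      rw [h3]; ring
    · rw [if_neg (by decide), if_neg (by decide), if_neg (by decide)]
      rw [if_pos rfl] at h4
      rw [h4]; ring
  have rs : IsRes 0 s := hs ▸ isRes_resPart 0 euler
  have ru : IsRes 1 u := hu ▸ isRes_resPart 1 euler
  have rt : IsRes 2 t := ht ▸ isRes_resPart 2 euler
  refine ⟨s, u, t, rs, ru, rt, hE, hu.trans resPart_one_euler, ?_⟩
  have m := fun k a b c (r : ZMod 5) hr => isRes_mul_pow rs ru rt k a b c (r := r) hr
  have key := (resPart_of_eq_sum (f := euler ^ 3)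
    ((m 1 3 0 0 0 rfl).add (m 3 0 1 2 0 rfl)) ((m 3 2 1 0 1 rfl).add (m 1 0 0 3 1 rfl))
    ((m 3 2 0 1 2 rfl).add (m 3 1 2 0 2 rfl)) ((m 6 1 1 1 3 rfl).add (m 1 0 3 0 3 rfl))
    ((m 3 1 0 2 4 rfl).add (m 3 0 2 1 4 rfl)) (by rw [hE]; push_cast; ring)).2.2.1
  rw [resPart_two_euler_cube] at key
  push_cast at key
  have h3s : 3 * s ≠ 0 := by
    intro h
    have h0 := congrArg (coeff 0) h
    have h1 : coeff 0 s = 1 := by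
      rw [hs, coeff_resPart, if_pos (by simp), coeff_zero_eq_constantCoeff_apply,
        constantCoeff_euler]
    have h3 : (3 : ℤ⟦X⟧) = C 3 := by simp
    rw [h3, coeff_C_mul, h1] at h0
    simp at h0
  refine (mul_eq_zero.1 (?_ : 3 * s * (s * t + u ^ 2) = 0)).resolve_left h3s
  rw [key]
  ring

theorem resPart_zero_lambert : resPart 0 lambert = expand 5 (by norm_num) lambert := by
  ext n
  rw [coeff_resPart, coeff_expand]
  have h := ZMod.natCast_eq_zero_iff n 5
  split_ifs with h1 h2 h2
  · obtain ⟨m, rfl⟩ := h2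
    rw [Nat.mul_div_cancel_left _ (by norm_num)]
    have h5 : (5 : ℤ⟦X⟧) = C 5 := by simp
    rw [lambert, map_sub, map_sub, h5, coeff_C_mul, coeff_C_mul, coeff_mk, coeff_mk,
      sigmaChi_five_mul, coeff_one, coeff_one]
    simp
  · exact absurd (h.1 h1) h2
  · exact absurd (h.2 h2) h1
  · rfl

/-- The five-dissection of `q E₅⁵ / E₁` compared with that of `E₁⁵ / E₅`. -/
theorem resPart_X_mul_core {F : ℤ⟦X⟧} (hF : F * euler = eulerAt 5 ^ 5) :
    resPart 0 (X * F) = 5 * expand 5 (by norm_num) (X * F) ∧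
    resPart 1 lambert = -5 * resPart 1 (X * F) ∧ resPart 2 lambert = 5 * resPart 2 (X * F) ∧
    resPart 3 lambert = 5 * resPart 3 (X * F) ∧ resPart 4 lambert = -5 * resPart 4 (X * F) := by
  obtain ⟨s, u, t, rs, ru, rt, hE, hu, hst⟩ := exists_euler_dissection
  have m := fun k a b c (r : ZMod 5) hr => isRes_mul_pow rs ru rt k a b c (r := r) hr
  have h5 := euler_pow_five
  have hr5 : IsRes 0 (eulerAt 5) := isRes_expand euler
  obtain ⟨p0, p1, p2, p3, p4⟩ := resPart_of_eq_sum (f := euler ^ 5)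
    (((((m 1 5 0 0 0 rfl).add (m 1 0 5 0 0 rfl)).add (m 1 0 0 5 0 rfl)).add
      (m 30 2 1 2 0 rfl)).add (m 20 1 3 1 0 rfl))
    ((((m 5 4 1 0 1 rfl).add (m 10 2 0 3 1 rfl)).add (m 30 1 2 2 1 rfl)).add (m 5 0 4 1 1 rfl))
    ((((m 5 4 0 1 2 rfl).add (m 10 3 2 0 2 rfl)).add (m 20 1 1 3 2 rfl)).add (m 10 0 3 2 2 rfl))
    ((((m 20 3 1 1 3 rfl).add (m 10 2 3 0 3 rfl)).add (m 5 1 0 4 3 rfl)).add (m 10 0 2 3 3 rfl))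
    (((((m 10 3 0 2 4 rfl).add (m 30 2 2 1 4 rfl)).add (m 5 1 4 0 4 rfl)).add
      (m 5 0 1 4 4 rfl))) (by rw [hE]; push_cast; ring)
  rw [h5, resPart_mul hr5] at p0 p1 p2 p3 p4
  rw [resPart_zero_lambert] at p0
  push_cast at p0 p1 p2 p3 p4
  -- `N` is the cofactor in `(s + u + t) N = s⁵ + t⁵ + 11 u⁵`.
  set N := s ^ 4 - s ^ 3 * u + 2 * s ^ 2 * u ^ 2 - 3 * s * u ^ 3 + 5 * u ^ 4 + t ^ 4 - t ^ 3 * u +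
    2 * t ^ 2 * u ^ 2 - 3 * t * u ^ 3 with hN
  have hD : euler * N = s ^ 5 + t ^ 5 + 11 * u ^ 5 := by
    rw [hE, hN]
    linear_combination (s ^ 3 - s ^ 2 * u + 2 * s * u ^ 2 + t ^ 3 - t ^ 2 * u + 2 * t * u ^ 2 -
      6 * u ^ 3) * hst
  have hD' : eulerAt 5 * expand 5 (by norm_num) lambert = euler * N := by
    rw [p0, hD]
    linear_combination (30 * u * (s * t - u ^ 2) + 20 * u ^ 3) * hst
  have hL : eulerAt 5 ^ 5 = eulerAt 25 * expand 5 (by norm_num) lambert := by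
    have := congrArg (expand 5 (by norm_num)) h5
    rw [map_mul, map_pow] at this
    exact this.trans (congrArg (· * _) (eulerAt_expand 5 5))
  have hL0 : expand 5 (by norm_num) lambert ≠ 0 := by
    intro h
    rw [h, mul_zero] at hL
    exact eulerAt_ne_zero 5 (pow_eq_zero_iff (by norm_num) |>.1 hL)
  have hFN : F * eulerAt 5 = eulerAt 25 * N := by
    refine mul_right_cancel₀ hL0 ?_
    linear_combination F * hD' + N * hF + N * hL
  have hXF : eulerAt 5 * (X * F) = -u * N := by
    rw [hu]
    linear_combination X * hFN
  obtain ⟨c0, c1, c2, c3, c4⟩ := resPart_of_eq_sum (f := eulerAt 5 * (X * F))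
    (m (-5) 0 5 0 0 rfl) ((m (-1) 4 1 0 1 rfl).add (m 3 0 4 1 1 rfl))
    ((m 1 3 2 0 2 rfl).add (m (-2) 0 3 2 2 rfl)) ((m (-2) 2 3 0 3 rfl).add (m 1 0 2 3 3 rfl))
    ((m 3 1 4 0 4 rfl).add (m (-1) 0 1 4 4 rfl)) (by rw [hXF, hN]; push_cast; ring)
  rw [resPart_mul hr5] at c0 c1 c2 c3 c4
  push_cast at c0 c1 c2 c3 c4
  have h50 := eulerAt_ne_zero 5
  refine ⟨?_, ?_, ?_, ?_, ?_⟩ <;> refine mul_left_cancel₀ h50 ?_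
  · have h6 := congrArg (expand 5 (by norm_num)) hF
    rw [map_mul, map_pow] at h6
    have h7 : expand 5 (by norm_num) (eulerAt 5) = eulerAt 25 := eulerAt_expand 5 5
    have h8 : expand 5 (by norm_num) euler = eulerAt 5 := rfl
    rw [h7, h8] at h6
    rw [c0, map_mul, expand_X, hu]
    linear_combination -5 * X ^ 5 * h6
  · linear_combination p1 + 5 * c1 + 10 * t * (s * t + 2 * u ^ 2) * hst
  · linear_combination p2 - 5 * c2 + (5 * s ^ 3 + 20 * u * t ^ 2) * hst
  · linear_combination p3 - 5 * c3 + (20 * s ^ 2 * u + 5 * t ^ 3) * hst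
  · linear_combination p4 + 5 * c4 + 10 * s * (s * t + 2 * u ^ 2) * hst

/-! ### The generating function of the lattice attached to `5`-cores -/

/-- The exponent attached to a vector `v`; on vectors with coordinate sum `0` it is the quadratic
form `(5/2) ∑ v_r ^ 2 + ∑ r v_r` of Garvan, Kim and Stanton. -/
def coreExp (v : Fin 5 → ℤ) : ℕ := ∑ r : Fin 5, jacobiExp 5 r (v r)

theorem finite_coreExp_le (d : ℕ) : {v | coreExp v ≤ d}.Finite := by
  refine (Set.Finite.pi' fun r : Fin 5 => finite_jacobiExp_le (s := 5) (a := r) (by norm_num)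
    (by omega) d).subset fun v hv r => ?_
  exact (Finset.single_le_sum (f := fun r : Fin 5 => jacobiExp 5 r (v r))
    (fun _ _ => Nat.zero_le _) (Finset.mem_univ r)).trans hv

/-- A translation by `M` turns the weight of a bead configuration into `coreExp`. -/
theorem sum_weight_eq {M : ℕ} {m : Fin 5 → ℕ} {v : Fin 5 → ℤ} (hm : ∀ r, (m r : ℤ) = M + v r)
    (hv : ∑ r, v r = 0) :
    ∑ r : Fin 5, (5 * (m r).choose 2 + r * m r) = (5 * M).choose 2 + coreExp v := by
  have key : ∀ r : Fin 5, 2 * ((5 * (m r).choose 2 + r * m r : ℕ) : ℤ) =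
      5 * (M * (M - 1)) + 2 * r * M + 10 * M * v r + 2 * jacobiExp 5 r (v r) := fun r => by
    have h1 := two_mul_jacobiExp (s := 5) (a := r) (by omega) (v r)
    have h2 := two_mul_choose_two (m r)
    rw [hm] at h2
    push_cast
    rw [hm]
    push_cast at h1
    linear_combination 5 * h2 - h1
  zify
  refine mul_left_cancel₀ (two_ne_zero (α := ℤ)) ?_
  have h3 := two_mul_choose_two (5 * M)
  rw [mul_add, h3, coreExp]
  push_cast at key ⊢
  rw [Finset.mul_sum, Finset.sum_congr rfl fun r _ => key r]
  simp only [Finset.sum_add_distrib, ← Finset.mul_sum, hv]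
  simp [Fin.sum_univ_five]
  ring

theorem prod_range_mul_eq {R : Type*} [CommMonoid R] (g : ℕ → R) (s K : ℕ) :
    ∏ i ∈ Finset.range (s * K), g i =
      ∏ j ∈ Finset.range K, ∏ r ∈ Finset.range s, g (r + s * j) := by
  induction K with
  | zero => simp
  | succ K ih =>
    rw [mul_add_one, Finset.prod_range_add, ih, Finset.prod_range_succ]
    simp only [add_comm]

/-- The coefficient of `t ^ (5 M)` in `∏_{i < 10 M} (1 + t q ^ i)`, computed from the `q`-binomial
theorem for the whole product and for its five parts with `i` in a fixed class modulo `5`. -/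
theorem gauss_ten_mul_eq_sum (M : ℕ) :
    gauss ((X : ℤ⟦X⟧) ^ 1) (2 * (5 * M)) (((5 * M : ℕ) : ℤ) + 0).toNat =
      ∑ v ∈ Fintype.piFinset fun _ : Fin 5 => Finset.Icc (-(M : ℤ)) M,
        monomial (coreExp v) (if ∑ r, v r = 0 then 1 else 0) *
          ∏ r, gauss ((X : ℤ⟦X⟧) ^ 5) (2 * M) ((M : ℤ) + v r).toNat := by
  have hC : ∀ q : ℤ⟦X⟧, ∀ n k, gauss (Polynomial.C q) n k = Polynomial.C (gauss q n k) :=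
    fun q => gauss_map Polynomial.C q
  have h1 := prod_add_mul_pow (Polynomial.C (X : ℤ⟦X⟧)) 1 Polynomial.X (2 * (5 * M))
  have h2 : ∀ r : Fin 5, ∏ j ∈ Finset.range (2 * M),
      (1 + Polynomial.X * Polynomial.C (X : ℤ⟦X⟧) ^ (r + 5 * j)) =
      ∑ v ∈ Finset.Icc (-(M : ℤ)) M, Polynomial.C (gauss ((X : ℤ⟦X⟧) ^ 5) (2 * M)
        ((M : ℤ) + v).toNat * X ^ (5 * ((M : ℤ) + v).toNat.choose 2 + r * ((M : ℤ) + v).toNat)) *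
        Polynomial.X ^ ((M : ℤ) + v).toNat := fun r => by
    have := prod_add_mul_pow (Polynomial.C ((X : ℤ⟦X⟧) ^ 5)) 1
      (Polynomial.X * Polynomial.C ((X : ℤ⟦X⟧) ^ (r : ℕ))) (2 * M)
    rw [sum_range_eq_sum_Icc] at this
    refine Eq.trans (Finset.prod_congr rfl fun j _ => ?_)
      (this.trans (Finset.sum_congr rfl fun v _ => ?_))
    · simp only [map_pow]; ring
    · rw [hC]; simp only [map_mul, map_pow, one_pow]; ring
  have h3 : ∏ i ∈ Finset.range (2 * (5 * M)), (1 + Polynomial.X * Polynomial.C (X : ℤ⟦X⟧) ^ i) =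
      ∏ r : Fin 5, ∏ j ∈ Finset.range (2 * M),
        (1 + Polynomial.X * Polynomial.C (X : ℤ⟦X⟧) ^ ((r : ℕ) + 5 * j)) := by
    rw [Fin.prod_univ_eq_prod_range (fun r => ∏ j ∈ Finset.range (2 * M),
        (1 + Polynomial.X * Polynomial.C (X : ℤ⟦X⟧) ^ (r + 5 * j))) 5, Finset.prod_comm,
      show 2 * (5 * M) = 5 * (2 * M) by ring]
    exact prod_range_mul_eq _ 5 (2 * M)
  rw [h3, Finset.prod_congr rfl fun r _ => h2 r, Finset.prod_univ_sum] at h1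
  have h4 := congrArg (fun p => Polynomial.coeff p (5 * M)) h1
  simp only [Finset.prod_mul_distrib, Finset.prod_pow_eq_pow_sum, ← map_prod,
    Polynomial.finsetSum_coeff, Polynomial.coeff_C_mul_X_pow, one_pow, mul_one, hC, ← map_pow,
    ← map_mul] at h4
  rw [Finset.sum_ite_eq, if_pos (Finset.mem_range.2 (by omega))] at h4
  rw [add_zero, Int.toNat_natCast, pow_one]
  refine mul_right_cancel₀ (pow_ne_zero ((5 * M).choose 2) (X_ne_zero (R := ℤ))) ?_
  rw [← h4, Finset.sum_mul]
  refine Finset.sum_congr rfl fun v hv => ?_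
  have hm : ∀ r, ((((M : ℤ) + v r).toNat : ℕ) : ℤ) = M + v r := fun r => by
    have := Finset.mem_Icc.1 (Fintype.mem_piFinset.1 hv r)
    omega
  have hiff : 5 * M = ∑ r, ((M : ℤ) + v r).toNat ↔ ∑ r, v r = 0 := by
    zify
    simp only [hm, Finset.sum_add_distrib]
    simp
  rw [if_congr hiff rfl rfl]
  split_ifs with h
  · rw [sum_weight_eq hm h, ← X_pow_eq, pow_add]
    ring
  · simp

/-- The vectors counted by `n ↦ #{v : ∑ v_r = 0, coreExp v = n}` have generating function
`∏ (1 - q ^ (5 n)) ^ 5 / (1 - q ^ n)`. -/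
theorem latticeSeries_mul_euler :
    (PowerSeries.mk fun n => ({v : Fin 5 → ℤ | ∑ r, v r = 0 ∧ coreExp v = n}.ncard : ℤ)) * euler =
      eulerAt 5 ^ 5 := by
  have hfin : ∀ n, {v | coreExp v = n}.Finite := fun n =>
    (finite_coreExp_le n).subset fun _ hv => le_of_eq hv
  have hsum := hasSum_monomial (fun v : Fin 5 → ℤ => if ∑ r, v r = 0 then 1 else 0)
    (e := coreExp) (s := fun n => (hfin n).toFinset) (fun n v hv => by simpa using hv)
  have h1 := tendsto_sum_monomial_mul finite_coreExp_le hsum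
    (S := fun M : ℕ => Fintype.piFinset fun _ : Fin 5 => Finset.Icc (-(M : ℤ)) M)
    (fun v => by
      simp only [Fintype.mem_piFinset]
      exact eventually_all.2 fun r => eventually_mem_Icc (v r))
    (A := fun M v => ∏ r, gauss ((X : ℤ⟦X⟧) ^ 5) (2 * M) ((M : ℤ) + v r).toNat)
    (L := ∏ _r : Fin 5, eulerInv 5)
    (fun v => tendsto_finsetProd _ fun r _ => tendsto_gauss 5 (v r))
  have h2 := (tendsto_gauss 1 0).comp (tendsto_id.const_mul_atTop' (show 0 < 5 by norm_num))
  have h3 := tendsto_nhds_unique (h2.congr fun M => gauss_ten_mul_eq_sum M) h1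
  have hser : (PowerSeries.mk fun n =>
      ({v : Fin 5 → ℤ | ∑ r, v r = 0 ∧ coreExp v = n}.ncard : ℤ)) =
      PowerSeries.mk fun n => ∑ v ∈ (hfin n).toFinset.filter (coreExp · = n),
        if ∑ r, v r = 0 then (1 : ℤ) else 0 := by
    ext n
    rw [coeff_mk, coeff_mk, Finset.sum_boole, ← Set.ncard_coe_finset]
    congr 2
    ext v
    simp [and_comm]
  rw [hser]
  rw [Finset.prod_const, Finset.card_univ, Fintype.card_fin] at h3
  have h4 := eulerInv_mul 1
  have h5 := eulerInv_mul 5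
  rw [eulerAt_one] at h4
  have h6 : eulerInv 5 ^ 5 * eulerAt 5 ^ 5 = 1 := by rw [← mul_pow, h5, one_pow]
  generalize (PowerSeries.mk fun n => ∑ v ∈ (hfin n).toFinset.filter (coreExp · = n),
        if ∑ r, v r = 0 then (1 : ℤ) else 0) = f at h3 ⊢
  linear_combination (-(f * euler)) * h6 - euler * eulerAt 5 ^ 5 * h3 + eulerAt 5 ^ 5 * h4

/-! ### Partitions and sets of beta-numbers -/

/-- The beta-numbers (first-column hook lengths, shifted) of a partition with `N` parts, some of
which may be zero; the `i`-th smallest of them is `i` plus the `i`-th smallest part. -/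
def betaNumber (N : ℕ) (μ : YoungDiagram) (i : Fin N) : ℕ := μ.rowLen (N - 1 - i) + i

/-- The set of the `N` beta-numbers of a partition with at most `N` parts. -/
def betaSet (N : ℕ) (μ : YoungDiagram) : Finset ℕ := Finset.univ.image (betaNumber N μ)

theorem strictMono_betaNumber (N : ℕ) (μ : YoungDiagram) : StrictMono (betaNumber N μ) := by
  intro i j hij
  have h1 : μ.rowLen (N - 1 - i) ≤ μ.rowLen (N - 1 - j) := μ.rowLen_anti _ _ (by omega)
  have h2 : (i : ℕ) < j := hij
  rw [betaNumber, betaNumber]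
  omega

theorem card_betaSet (N : ℕ) (μ : YoungDiagram) : (betaSet N μ).card = N := by
  rw [betaSet, Finset.card_image_of_injective _ (strictMono_betaNumber N μ).injective]
  simp

theorem mem_betaSet {N : ℕ} {μ : YoungDiagram} {x : ℕ} :
    x ∈ betaSet N μ ↔ ∃ i < N, x = μ.rowLen i + (N - 1 - i) := by
  simp only [betaSet, betaNumber, Finset.mem_image, Finset.mem_univ, true_and]
  constructor
  · rintro ⟨i, rfl⟩
    exact ⟨N - 1 - i, by omega, by omega⟩
  · rintro ⟨i, hi, rfl⟩
    refine ⟨⟨N - 1 - i, by omega⟩, ?_⟩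
    have : N - 1 - (N - 1 - i) = i := by omega
    simp [this]

theorem rowLen_eq_zero {μ : YoungDiagram} {i : ℕ} (h : μ.card ≤ i) : μ.rowLen i = 0 := by
  by_contra h0
  have h1 : (i, 0) ∈ μ := YoungDiagram.mem_iff_lt_rowLen.2 (Nat.pos_of_ne_zero h0)
  have h2 : i < μ.colLen 0 := YoungDiagram.mem_iff_lt_colLen.1 h1
  have h3 : μ.colLen 0 ≤ μ.card := by
    rw [YoungDiagram.colLen_eq_card]
    exact Finset.card_le_card (Finset.filter_subset _ _)
  omega

theorem sum_rowLen {N : ℕ} {μ : YoungDiagram} (h : ∀ i, N ≤ i → μ.rowLen i = 0) :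
    ∑ i ∈ Finset.range N, μ.rowLen i = μ.card := by
  rw [YoungDiagram.card, Finset.card_eq_sum_card_fiberwise (f := Prod.fst) (t := Finset.range N)]
  · refine Finset.sum_congr rfl fun i _ => ?_
    rw [YoungDiagram.rowLen_eq_card, YoungDiagram.row]
  · rintro ⟨i, j⟩ hij
    have h1 : j < μ.rowLen i := YoungDiagram.mem_iff_lt_rowLen.1 hij
    rw [Finset.mem_coe, Finset.mem_range]
    by_contra! hc
    rw [h i hc] at h1
    omega

theorem sum_betaSet {N : ℕ} {μ : YoungDiagram} (h : ∀ i, N ≤ i → μ.rowLen i = 0) :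
    ∑ x ∈ betaSet N μ, x = μ.card + N.choose 2 := by
  rw [betaSet, Finset.sum_image (strictMono_betaNumber N μ).injective.injOn, ← sum_rowLen h]
  simp only [betaNumber, Finset.sum_add_distrib]
  rw [Fin.sum_univ_eq_sum_range (fun i => μ.rowLen (N - 1 - i)) N,
    Fin.sum_univ_eq_sum_range (fun i => i) N, Finset.sum_range_reflect, Finset.sum_range_id,
    Nat.choose_two_right]

theorem betaSet_injOn (N : ℕ) :
    Set.InjOn (betaSet N) {μ : YoungDiagram | ∀ i, N ≤ i → μ.rowLen i = 0} := by
  intro μ hμ ν hν h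
  have h1 : betaNumber N μ = betaNumber N ν := by
    refine ((strictMono_betaNumber N μ).range_inj (strictMono_betaNumber N ν)).1 ?_
    simpa [betaSet] using congrArg (fun s : Finset ℕ => (s : Set ℕ)) h
  have h2 : ∀ i, μ.rowLen i = ν.rowLen i := fun i => by
    rcases lt_or_ge i N with hi | hi
    · have := congrFun h1 ⟨N - 1 - i, by omega⟩
      have e : N - 1 - (N - 1 - i) = i := by omega
      simpa [betaNumber, e] using this
    · rw [hμ i hi, hν i hi]
  refine YoungDiagram.ext (Finset.ext fun ⟨i, j⟩ => ?_)
  rw [YoungDiagram.mem_cells, YoungDiagram.mem_cells, YoungDiagram.mem_iff_lt_rowLen,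
    YoungDiagram.mem_iff_lt_rowLen, h2]

/-- The Young diagram with prescribed row lengths. -/
def ofAntitone (N : ℕ) (f : ℕ → ℕ) (hf : Antitone f) : YoungDiagram where
  cells := (Finset.range N ×ˢ Finset.range (f 0)).filter fun p => p.2 < f p.1
  isLowerSet := by
    rintro ⟨i, j⟩ ⟨i', j'⟩ ⟨h1, h2⟩ h
    simp only [Finset.coe_filter, Finset.mem_product, Finset.mem_range, Set.mem_ofPred_eq] at h ⊢
    have h3 : i' ≤ i := h1
    have h4 : j' ≤ j := h2
    have h5 := hf h3
    omega

theorem rowLen_ofAntitone {N : ℕ} {f : ℕ → ℕ} (hf : Antitone f) (h0 : ∀ i, N ≤ i → f i = 0)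
    (i : ℕ) : (ofAntitone N f hf).rowLen i = f i := by
  refine eq_of_forall_lt_iff fun j => ?_
  rw [← YoungDiagram.mem_iff_lt_rowLen, ← YoungDiagram.mem_cells, ofAntitone]
  simp only [Finset.mem_filter, Finset.mem_product, Finset.mem_range]
  constructor
  · exact fun h => h.2
  · intro h
    have h1 := hf (Nat.zero_le i)
    refine ⟨⟨?_, by omega⟩, h⟩
    by_contra! hc
    rw [h0 i hc] at h
    omega

theorem exists_betaSet_eq (S : Finset ℕ) :
    ∃ μ : YoungDiagram, (∀ i, S.card ≤ i → μ.rowLen i = 0) ∧ betaSet S.card μ = S := by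
  set N := S.card with hN
  set x := S.orderEmbOfFin hN.symm
  have hx : ∀ i j : Fin N, i ≤ j → x i + (j - i) ≤ x j := by
    intro i j hij
    obtain ⟨d, hd⟩ := Nat.exists_eq_add_of_le (Fin.le_def.1 hij)
    induction d generalizing j with
    | zero =>
      have : i = j := Fin.ext (by omega)
      subst this; simp
    | succ d ih =>
      have hjd : (i : ℕ) + d < N := by have := j.2; omega
      have h1 := ih ⟨i + d, hjd⟩ (Fin.le_def.2 (by simp)) rfl
      have h2 : x ⟨i + d, hjd⟩ < x j := x.strictMono (Fin.lt_def.2 (by simp only; omega))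
      simp only at h1
      omega
  have hlow : ∀ i : Fin N, (i : ℕ) ≤ x i := fun i => by
    have := hx ⟨0, i.pos⟩ i (Fin.le_def.2 (by simp))
    simp only at this
    omega
  set f : ℕ → ℕ := fun i => if h : i < N then x ⟨N - 1 - i, by omega⟩ - (N - 1 - i) else 0
  have hf : Antitone f := by
    intro i j hij
    simp only [f]
    split_ifs with h1 h2
    · have := hx ⟨N - 1 - j, by omega⟩ ⟨N - 1 - i, by omega⟩ (Fin.le_def.2 (by simp; omega))
      simp only at this
      omega
    · omega
    · omega
    · omega
  have h0 : ∀ i, N ≤ i → f i = 0 := fun i hi => by simp only [f]; rw [dif_neg (by omega)]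
  refine ⟨ofAntitone N f hf, fun i hi => by rw [rowLen_ofAntitone hf h0, h0 i hi], ?_⟩
  have hb : betaNumber N (ofAntitone N f hf) = x := by
    funext i
    rw [betaNumber, rowLen_ofAntitone hf h0]
    simp only [f]
    rw [dif_pos (by omega)]
    have e : N - 1 - (N - 1 - (i : ℕ)) = i := by omega
    simp only [e, Fin.eta]
    exact Nat.sub_add_cancel (hlow i)
  rw [betaSet, hb]
  ext y
  rw [Finset.mem_image, ← Finset.mem_coe, ← Finset.range_orderEmbOfFin S hN.symm]
  simp only [Finset.mem_univ, true_and, Set.mem_range]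
  rfl

/-! ### Cores and closed sets of beta-numbers -/

/-- A set of natural numbers is `t`-closed if it is stable under `x ↦ x - t` on `x ≥ t`: on the
abacus with `t` runners, all beads are pushed up as far as they go. -/
def IsClosedUnderSub (t : ℕ) (S : Finset ℕ) : Prop := ∀ y, y + t ∈ S → y ∈ S

/-- The `j`-th smallest natural number that is not a beta-number. -/
def betaGap (N : ℕ) (μ : YoungDiagram) (j : ℕ) : ℕ := j + N - μ.colLen j

theorem colLen_le {N : ℕ} {μ : YoungDiagram} (h : ∀ i, N ≤ i → μ.rowLen i = 0) (j : ℕ) :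
    μ.colLen j ≤ N := by
  by_contra! hc
  have h1 := YoungDiagram.mem_iff_lt_rowLen.1 (YoungDiagram.mem_iff_lt_colLen.2 hc)
  rw [h N le_rfl] at h1
  omega

/-- The hook number at a node is the difference of a beta-number and a gap. -/
theorem hookNumber_add_betaGap {N : ℕ} {μ : YoungDiagram} (h : ∀ i, N ≤ i → μ.rowLen i = 0)
    {i j : ℕ} (hij : (i, j) ∈ μ) :
    0 < hookNumber μ i j ∧
      hookNumber μ i j + betaGap N μ j = μ.rowLen i + (N - 1 - i) := by
  have h1 := YoungDiagram.mem_iff_lt_rowLen.1 hij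
  have h2 := YoungDiagram.mem_iff_lt_colLen.1 hij
  have h3 := colLen_le h j
  rw [hookNumber, betaGap]
  omega

theorem lt_betaGap {N : ℕ} {μ : YoungDiagram} (h : ∀ i, N ≤ i → μ.rowLen i = 0) {i j : ℕ}
    (hi : i < N) (hij : (i, j) ∉ μ) : μ.rowLen i + (N - 1 - i) < betaGap N μ j := by
  have h1 := mt YoungDiagram.mem_iff_lt_rowLen.2 hij
  have h2 := mt YoungDiagram.mem_iff_lt_colLen.2 hij
  have h3 := colLen_le h j
  rw [betaGap]
  omega

theorem betaGap_notMem {N : ℕ} {μ : YoungDiagram} (h : ∀ i, N ≤ i → μ.rowLen i = 0) (j : ℕ) :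
    betaGap N μ j ∉ betaSet N μ := by
  rw [mem_betaSet]
  rintro ⟨i, hi, he⟩
  by_cases hij : (i, j) ∈ μ
  · have := hookNumber_add_betaGap h hij
    omega
  · have := lt_betaGap h hi hij
    omega

theorem exists_betaGap_eq {N : ℕ} {μ : YoungDiagram} (h : ∀ i, N ≤ i → μ.rowLen i = 0) {y : ℕ}
    (hy : y ∉ betaSet N μ) : ∃ j, betaGap N μ j = y := by
  have hex : ∃ i, μ.rowLen i + N ≤ y + i + 1 := ⟨N, by rw [h N le_rfl]; omega⟩
  classical
  set i := Nat.find hex with hi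
  have h1 : μ.rowLen i + N ≤ y + i + 1 := Nat.find_spec hex
  have h2 : ∀ k < i, ¬ μ.rowLen k + N ≤ y + k + 1 := fun k hk => Nat.find_min hex hk
  have hiN : i ≤ N := Nat.find_min' hex (by rw [h N le_rfl]; omega)
  have h3 : μ.rowLen i + N ≤ y + i := by
    by_contra! hc
    rcases hiN.lt_or_eq with h4 | h4
    · exact hy (mem_betaSet.2 ⟨i, h4, by omega⟩)
    · rw [h4, h N le_rfl] at hc
      omega
  -- Row `i` does not reach column `y + i - N`, but all rows above do.
  have h5 : μ.colLen (y + i - N) = i := by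
    refine eq_of_forall_lt_iff fun k => ?_
    rw [← YoungDiagram.mem_iff_lt_colLen, YoungDiagram.mem_iff_lt_rowLen]
    constructor
    · intro hk
      by_contra! hc
      have := μ.rowLen_anti _ _ hc
      omega
    · intro hk
      have := h2 (i - 1) (by omega)
      have := μ.rowLen_anti _ _ (show k ≤ i - 1 by omega)
      omega
  exact ⟨y + i - N, by rw [betaGap, h5]; omega⟩

theorem isCore_iff_isClosedUnderSub {t N : ℕ} (ht : 0 < t) {μ : YoungDiagram}
    (h : ∀ i, N ≤ i → μ.rowLen i = 0) : IsCore t μ ↔ IsClosedUnderSub t (betaSet N μ) := by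
  constructor
  · intro hc y hy
    by_contra hn
    obtain ⟨j, rfl⟩ := exists_betaGap_eq h hn
    obtain ⟨i, hi, he⟩ := mem_betaSet.1 hy
    by_cases hij : (i, j) ∈ μ
    · refine hc i j hij ?_
      have := hookNumber_add_betaGap h hij
      have e : hookNumber μ i j = t := by omega
      rw [e]
    · have := lt_betaGap h hi hij
      omega
  · rintro hc i j hij ⟨k, hk⟩
    have h1 := hookNumber_add_betaGap h hij
    have hi : i < N := by
      by_contra! hn
      have h2 := YoungDiagram.mem_iff_lt_rowLen.1 hij
      rw [h i hn] at h2
      omega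
    have h3 : ∀ k, betaGap N μ j + t * k ∈ betaSet N μ → betaGap N μ j ∈ betaSet N μ := by
      intro k
      induction k with
      | zero => exact id
      | succ k ih => exact fun h' => ih (hc _ (by rwa [mul_add_one, ← add_assoc] at h'))
    refine betaGap_notMem h j (h3 k ?_)
    rw [← hk, add_comm, h1.2]
    exact mem_betaSet.2 ⟨i, hi, rfl⟩

/-- The set of positions of `m r` beads pushed to the top of runner `r`, on `t` runners. -/
def abacus {t : ℕ} (m : Fin t → ℕ) : Finset ℕ :=
  (Finset.univ.sigma fun r => Finset.range (m r)).image fun p : (_ : Fin t) × ℕ => p.1 + t * p.2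

theorem abacus_injective (t : ℕ) :
    Function.Injective fun p : (_ : Fin t) × ℕ => (p.1 : ℕ) + t * p.2 := by
  rintro ⟨r, k⟩ ⟨r', k'⟩ h
  simp only at h
  have h1 := congrArg (· % t) h
  simp only [Nat.add_mul_mod_self_left, Nat.mod_eq_of_lt r.2, Nat.mod_eq_of_lt r'.2] at h1
  have h2 := Fin.ext h1
  subst h2
  have h3 : t * k = t * k' := by omega
  have h4 := Nat.eq_of_mul_eq_mul_left r.pos h3
  rw [h4]

theorem mem_abacus {t : ℕ} {m : Fin t → ℕ} (r : Fin t) (k : ℕ) :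
    (r : ℕ) + t * k ∈ abacus m ↔ k < m r := by
  have := Finset.mem_map' (f := ⟨_, abacus_injective t⟩)
    (s := Finset.univ.sigma fun r => Finset.range (m r)) (a := ⟨r, k⟩)
  rw [Finset.map_eq_image] at this
  simpa [abacus] using this

theorem card_abacus {t : ℕ} (m : Fin t → ℕ) : (abacus m).card = ∑ r, m r := by
  rw [abacus, Finset.card_image_of_injective _ (abacus_injective t), Finset.card_sigma]
  simp

theorem sum_abacus {t : ℕ} (m : Fin t → ℕ) :
    ∑ x ∈ abacus m, x = ∑ r : Fin t, (t * (m r).choose 2 + r * m r) := by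
  rw [abacus, Finset.sum_image (abacus_injective t).injOn, Finset.sum_sigma]
  refine Finset.sum_congr rfl fun r _ => ?_
  rw [Finset.sum_add_distrib, ← Finset.mul_sum, Finset.sum_range_id, Nat.choose_two_right]
  simp
  ring

theorem abacus_inj {t : ℕ} {m m' : Fin t → ℕ} (h : abacus m = abacus m') : m = m' := by
  funext r
  refine eq_of_forall_lt_iff fun k => ?_
  rw [← mem_abacus, ← mem_abacus, h]

theorem isClosedUnderSub_abacus {t : ℕ} (m : Fin t → ℕ) : IsClosedUnderSub t (abacus m) := by
  intro y hy
  rcases Nat.eq_zero_or_pos t with rfl | ht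
  · exact hy
  have e := Nat.mod_add_div y t
  have h1 := mem_abacus (m := m) ⟨y % t, Nat.mod_lt _ ht⟩
  have h2 := h1 (y / t + 1)
  have h3 := h1 (y / t)
  simp only [mul_add_one] at h2 h3
  rw [← add_assoc, e] at h2
  rw [e] at h3
  rw [h3]
  have := h2.1 hy
  omega

theorem exists_abacus_eq {t : ℕ} (ht : 0 < t) {S : Finset ℕ} (hS : IsClosedUnderSub t S) :
    ∃ m : Fin t → ℕ, abacus m = S := by
  classical
  have hex : ∀ r : Fin t, ∃ k, (r : ℕ) + t * k ∉ S := fun r => by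
    by_contra! hc
    refine Set.infinite_of_injective_forall_mem (f := fun k => (r : ℕ) + t * k) ?_ hc S.finite_toSet
    intro a b hab
    simp only at hab
    exact Nat.eq_of_mul_eq_mul_left ht (by omega)
  have hdown : ∀ (r : Fin t) (k d : ℕ), (r : ℕ) + t * (k + d) ∈ S → (r : ℕ) + t * k ∈ S := by
    intro r k d
    induction d with
    | zero => exact id
    | succ d ih => exact fun h => ih (hS _ (by rwa [← add_assoc, mul_add_one, ← add_assoc] at h))
  refine ⟨fun r => Nat.find (hex r), ?_⟩
  ext y
  have e := Nat.mod_add_div y t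
  have h1 := mem_abacus (m := fun r => Nat.find (hex r)) ⟨y % t, Nat.mod_lt _ ht⟩ (y / t)
  simp only [e] at h1
  rw [h1]
  have hspec := Nat.find_spec (hex ⟨y % t, Nat.mod_lt _ ht⟩)
  constructor
  · intro h
    have := Nat.find_min (hex ⟨y % t, Nat.mod_lt _ ht⟩) h
    simpa [e] using this
  · intro h
    by_contra! hc
    obtain ⟨d, hd⟩ := Nat.exists_eq_add_of_le hc
    refine hspec (hdown _ _ d ?_)
    rw [← hd]
    simpa only [e] using h

/-! ### The generating function of `5`-cores -/

theorem ncard_isCore_eq_ncard_isClosedUnderSub {t N n : ℕ} (ht : 0 < t) (hN : n ≤ N) :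
    c t n = {S : Finset ℕ | S.card = N ∧ IsClosedUnderSub t S ∧
      ∑ x ∈ S, x = n + N.choose 2}.ncard := by
  have hrow : ∀ μ : YoungDiagram, μ.card = n → ∀ i, N ≤ i → μ.rowLen i = 0 := fun μ hμ i hi =>
    rowLen_eq_zero (by omega)
  rw [c]
  refine Set.ncard_congr (fun μ _ => betaSet N μ) ?_ ?_ ?_
  · rintro μ ⟨hμ, hc⟩
    have h := hrow μ hμ
    exact ⟨card_betaSet N μ, (isCore_iff_isClosedUnderSub ht h).1 hc, by rw [sum_betaSet h, hμ]⟩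
  · rintro μ ν ⟨hμ, -⟩ ⟨hν, -⟩ h
    exact betaSet_injOn N (hrow μ hμ) (hrow ν hν) h
  · rintro S ⟨rfl, hS, hsum⟩
    obtain ⟨μ, h, he⟩ := exists_betaSet_eq S
    have h2 := sum_betaSet h
    rw [he, hsum] at h2
    refine ⟨μ, ⟨by omega, (isCore_iff_isClosedUnderSub ht h).2 (by rwa [he])⟩, he⟩

theorem neg_le_of_coreExp_le {v : Fin 5 → ℤ} {n : ℕ} (h : coreExp v ≤ n) (r : Fin 5) :
    -(n : ℤ) ≤ v r := by
  have h1 : jacobiExp 5 r (v r) ≤ n :=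
    (Finset.single_le_sum (f := fun r : Fin 5 => jacobiExp 5 r (v r))
      (fun _ _ => Nat.zero_le _) (Finset.mem_univ r)).trans h
  have h2 := two_mul_jacobiExp (s := 5) (a := r) (by omega) (v r)
  have h3 : ((r : ℕ) : ℤ) ≤ 4 := by omega
  have h4 : ((r : ℕ) : ℤ) ≥ 0 := by omega
  zify at h1
  push_cast at h2
  by_contra! hc
  nlinarith

/-- **Garvan, Kim and Stanton**: `5`-cores of `n` correspond to integer vectors of length `5` with
sum `0` and `coreExp v = n`; the vector records the excess of the number of beads on each runner. -/
theorem c_five_eq_ncard (n : ℕ) :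
    c 5 n = {v : Fin 5 → ℤ | ∑ r, v r = 0 ∧ coreExp v = n}.ncard := by
  rw [ncard_isCore_eq_ncard_isClosedUnderSub (N := 5 * n) (by norm_num) (by omega)]
  symm
  have hm : ∀ v : Fin 5 → ℤ, coreExp v = n → ∀ r, (((n + v r).toNat : ℕ) : ℤ) = n + v r := by
    intro v hv r
    have := neg_le_of_coreExp_le hv.le r
    omega
  refine Set.ncard_congr (fun v _ => abacus fun r => (n + v r).toNat) ?_ ?_ ?_
  · rintro v ⟨h0, hv⟩
    refine ⟨?_, isClosedUnderSub_abacus _, ?_⟩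
    · rw [card_abacus]
      zify
      simp only [hm v hv, Finset.sum_add_distrib, h0]
      simp
    · rw [sum_abacus, sum_weight_eq (hm v hv) h0, hv, add_comm]
  · rintro v w ⟨-, hv⟩ ⟨-, hw⟩ h
    funext r
    have h1 : ((n : ℤ) + v r).toNat = (n + w r).toNat := congrFun (abacus_inj h) r
    have h2 := hm v hv r
    have h3 := hm w hw r
    omega
  · rintro S ⟨hcard, hS, hsum⟩
    obtain ⟨m, rfl⟩ := exists_abacus_eq (by norm_num) hS
    rw [card_abacus] at hcard
    have h0 : ∑ r, ((m r : ℤ) - n) = 0 := by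
      rw [Finset.sum_sub_distrib, ← Nat.cast_sum, hcard]
      simp
    rw [sum_abacus, sum_weight_eq (M := n) (v := fun r => (m r : ℤ) - n) (fun r => by ring) h0]
      at hsum
    exact ⟨fun r => (m r : ℤ) - n, ⟨h0, by omega⟩, by simp⟩

/-- The generating function of `5`-cores. -/
noncomputable def coreSeries : PowerSeries ℤ := PowerSeries.mk fun n => (c 5 n : ℤ)

theorem coreSeries_mul_euler : coreSeries * euler = eulerAt 5 ^ 5 := by
  rw [← latticeSeries_mul_euler, coreSeries]
  simp only [c_five_eq_ncard]

/-! ### The generating function of `abar 5` in terms of `5`-cores -/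

theorem residueProd_two_one_mul_eulerAt_two : residueProd 2 1 (-1) * eulerAt 2 = euler := by
  rw [← eulerAt_one, ← residueProd_self 1, ← residueProd_self 2, residueProd_two]

theorem thetaOneNine_mul_thetaThreeSeven :
    thetaOneNine * thetaThreeSeven * eulerAt 5 * eulerAt 2 = euler * eulerAt 10 ^ 3 := by
  have h1 := prod_residueProd (s := 2) (k := 5) (by norm_num) (by norm_num) 1 (-1)
  have h2 := residueProd_two_one_mul_eulerAt_two
  have h3 := congrArg (expand 5 (by norm_num)) h2
  rw [map_mul, expand_residueProd (by norm_num), eulerAt_expand] at h3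
  simp only [Finset.prod_range_succ, Finset.prod_range_zero] at h1
  norm_num at h1 h3
  change _ = eulerAt 5 at h3
  rw [thetaOneNine, thetaThreeSeven, ← h3, ← h2, ← h1]
  ring

theorem thetaOneFour_mul_thetaTwoThree :
    thetaOneFour * thetaTwoThree * eulerAt 10 * euler = eulerAt 2 * eulerAt 5 ^ 3 := by
  have h1 := residueProd_five 1
  have h2 := residueProd_one_one_mul_euler
  have h3 := congrArg (expand 5 (by norm_num)) h2
  rw [map_mul, expand_residueProd (by norm_num), eulerAt_expand] at h3
  norm_num at h3
  change _ * eulerAt 5 = _ at h3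
  rw [thetaOneFour, thetaTwoThree, ← h3, ← h2, ← h1]
  ring

theorem eulerAt_relation_phiNeg :
    eulerAt 5 ^ 5 * eulerAt 2 ^ 2 - euler ^ 4 * eulerAt 5 * eulerAt 10 ^ 2 =
      4 * X * (euler * eulerAt 2 * eulerAt 10 ^ 5) := by
  have h1 := phiNeg_sq_sub
  have h2 := thetaOneNine_mul_thetaThreeSeven
  have h3 := phiNeg_mul_eulerAt_two
  have h4 := congrArg (expand 5 (by norm_num)) h3
  rw [map_mul, eulerAt_expand, map_pow] at h4
  change _ = eulerAt 5 ^ 2 at h4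
  generalize expand 5 _ phiNeg = f at *
  have h5 : euler ^ 4 = (phiNeg * eulerAt 2) ^ 2 := by rw [h3]; ring
  have h6 : eulerAt 5 ^ 5 = eulerAt 5 * (f * eulerAt 10) ^ 2 := by rw [h4]; ring
  rw [h5, h6]
  linear_combination eulerAt 2 ^ 2 * eulerAt 10 ^ 2 * eulerAt 5 * h1 +
    4 * X * eulerAt 2 * eulerAt 10 ^ 2 * h2

theorem eulerAt_relation_psi :
    eulerAt 2 ^ 4 * eulerAt 5 ^ 2 * eulerAt 10 - X * (euler ^ 2 * eulerAt 10 ^ 5) =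
      euler * eulerAt 2 * eulerAt 5 ^ 5 := by
  have h1 := psi_sq_sub
  have h2 := thetaOneFour_mul_thetaTwoThree
  have h3 := psi_mul_euler
  have h4 := congrArg (expand 5 (by norm_num)) h3
  rw [map_mul, map_pow, eulerAt_expand] at h4
  change _ * eulerAt 5 = _ at h4
  generalize expand 5 _ psi = f at *
  have h5 : eulerAt 2 ^ 4 = (psi * euler) ^ 2 := by rw [h3]; ring
  have h6 : eulerAt 10 ^ 5 = eulerAt 10 * (f * eulerAt 5) ^ 2 := by rw [h4]; ring
  rw [h5, h6]
  linear_combination euler ^ 2 * eulerAt 5 ^ 2 * eulerAt 10 * h1 + euler * eulerAt 5 ^ 2 * h2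

/-- Elimination in an integral domain. With `y = w / u` the hypotheses say that
`L = (1 - 4 y) ^ 2 (1 + y) F`, `L₂ = (1 - 4 y) (1 + y) ^ 2 F`, `x C = y F` and
`x ^ 2 C₂ = y ^ 2 F`. -/
theorem five_mul_eq_of_eta_relations {R : Type*} [CommRing R] [IsDomain R]
    {e₁ e₂ e₅ e₁₀ x F L L₂ C C₂ : R} (h₁ : e₁ ≠ 0) (h₂ : e₂ ≠ 0) (h₅ : e₅ ≠ 0) (h₁₀ : e₁₀ ≠ 0)
    (hF : F * (e₁₀ ^ 5 * e₁ ^ 2) = e₅ ^ 10 * e₂) (hL : e₅ * L = e₁ ^ 5) (hL₂ : e₁₀ * L₂ = e₂ ^ 5)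
    (hC : C * e₁ = e₅ ^ 5) (hC₂ : C₂ * e₂ = e₁₀ ^ 5)
    (ha : e₅ ^ 5 * e₂ ^ 2 - e₁ ^ 4 * e₅ * e₁₀ ^ 2 = 4 * x * (e₁ * e₂ * e₁₀ ^ 5))
    (hb : e₂ ^ 4 * e₅ ^ 2 * e₁₀ - x * (e₁ ^ 2 * e₁₀ ^ 5) = e₁ * e₂ * e₅ ^ 5) :
    5 * F = L + 4 * L₂ + 15 * (x * C) + 20 * (x ^ 2 * C₂) := by
  obtain ⟨u, hu⟩ : ∃ u, u = e₂ * e₅ ^ 5 := ⟨_, rfl⟩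
  obtain ⟨w, hw⟩ : ∃ w, w = x * e₁ * e₁₀ ^ 5 := ⟨_, rfl⟩
  have hA : e₂ * (u - 4 * w) = e₁ ^ 4 * e₅ * e₁₀ ^ 2 := by rw [hu, hw]; linear_combination ha
  have hB : e₁ * (u + w) = e₂ ^ 4 * e₅ ^ 2 * e₁₀ := by rw [hu, hw]; linear_combination -hb
  have k1 : u ^ 3 * L = (u - 4 * w) ^ 2 * (u + w) * F := by
    refine mul_left_cancel₀ (a := e₅ * (e₁₀ ^ 5 * e₁ ^ 2) * e₂ ^ 2 * e₁) (by positivity) ?_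
    calc _ = u ^ 3 * (e₅ * L) * (e₁₀ ^ 5 * e₁ ^ 2) * e₂ ^ 2 * e₁ := by ring
      _ = e₅ * (e₁ ^ 4 * e₅ * e₁₀ ^ 2) ^ 2 * (e₂ ^ 4 * e₅ ^ 2 * e₁₀) * (e₅ ^ 10 * e₂) := by
        rw [hL, hu]; ring
      _ = _ := by rw [← hA, ← hB, ← hF]; ring
  have k2 : u ^ 3 * L₂ = (u - 4 * w) * (u + w) ^ 2 * F := by
    refine mul_left_cancel₀ (a := e₁₀ * (e₁₀ ^ 5 * e₁ ^ 2) * e₂ * e₁ ^ 2) (by positivity) ?_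
    calc _ = u ^ 3 * (e₁₀ * L₂) * (e₁₀ ^ 5 * e₁ ^ 2) * e₂ * e₁ ^ 2 := by ring
      _ = e₁₀ * (e₁ ^ 4 * e₅ * e₁₀ ^ 2) * (e₂ ^ 4 * e₅ ^ 2 * e₁₀) ^ 2 * (e₅ ^ 10 * e₂) := by
        rw [hL₂, hu]; ring
      _ = _ := by rw [← hA, ← hB, ← hF]; ring
  have k3 : u * (x * C) = w * F := by
    refine mul_left_cancel₀ (a := e₁ * (e₁₀ ^ 5 * e₁ ^ 2)) (by positivity) ?_
    calc _ = u * x * (C * e₁) * (e₁₀ ^ 5 * e₁ ^ 2) := by ring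
      _ = w * e₁ * (e₅ ^ 10 * e₂) := by rw [hC, hu, hw]; ring
      _ = _ := by rw [← hF]; ring
  have k4 : u ^ 2 * (x ^ 2 * C₂) = w ^ 2 * F := by
    refine mul_left_cancel₀ (a := e₂ * (e₁₀ ^ 5 * e₁ ^ 2)) (by positivity) ?_
    calc _ = u ^ 2 * x ^ 2 * (C₂ * e₂) * (e₁₀ ^ 5 * e₁ ^ 2) := by ring
      _ = w ^ 2 * e₂ * (e₅ ^ 10 * e₂) := by rw [hC₂, hu, hw]; ring
      _ = _ := by rw [← hF]; ring
  have hu0 : u ^ 3 ≠ 0 := by rw [hu]; positivity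
  refine mul_left_cancel₀ hu0 ?_
  linear_combination -k1 - 4 * k2 - 15 * u ^ 2 * k3 - 20 * u * k4

/-- The generating function of `abar 5`. -/
noncomputable def abarSeries : ℤ⟦X⟧ := PowerSeries.mk fun n => abar 5 n

theorem abarSeries_mul_phiNeg : abarSeries * phiNeg = expand 5 (by norm_num) phiNeg ^ 5 := by
  have h1 : abarSeries = expand 5 (by norm_num) phiNeg ^ 5 * invOfUnit phiNeg 1 := by
    ext n
    rw [abarSeries, coeff_mk, abar]
  have h2 := mul_invOfUnit phiNeg 1 constantCoeff_phiNeg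
  rw [h1]
  linear_combination expand 5 (by norm_num) phiNeg ^ 5 * h2

theorem five_mul_abarSeries :
    5 * abarSeries = lambert + 4 * expand 2 (by norm_num) lambert + 15 * (X * coreSeries) +
      20 * (X ^ 2 * expand 2 (by norm_num) coreSeries) := by
  have hphi := phiNeg_mul_eulerAt_two
  have hphi5 := congrArg (expand 5 (by norm_num)) hphi
  rw [map_mul, eulerAt_expand, map_pow] at hphi5
  change _ = eulerAt 5 ^ 2 at hphi5
  have hL2 := congrArg (expand 2 (by norm_num)) euler_pow_five
  rw [map_mul, eulerAt_expand, map_pow] at hL2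
  change eulerAt 2 ^ 5 = _ at hL2
  have hC2 := congrArg (expand 2 (by norm_num)) coreSeries_mul_euler
  rw [map_mul, map_pow, eulerAt_expand] at hC2
  change _ * eulerAt 2 = _ at hC2
  have hF := abarSeries_mul_phiNeg
  refine five_mul_eq_of_eta_relations euler_ne_zero (eulerAt_ne_zero 2) (eulerAt_ne_zero 5)
    (eulerAt_ne_zero 10) ?_ euler_pow_five.symm hL2.symm coreSeries_mul_euler hC2
    eulerAt_relation_phiNeg eulerAt_relation_psi
  have h10 : eulerAt 5 ^ 10 = (expand 5 (by norm_num) phiNeg * eulerAt 10) ^ 5 := by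
    rw [hphi5]; ring
  rw [← hphi, h10, mul_pow, ← hF]
  ring

/-! ### Coefficients -/

theorem coeff_expand_two (f : ℤ⟦X⟧) (n : ℕ) :
    coeff n (expand 2 (by norm_num) f) = if n % 2 = 0 then coeff (n / 2) f else 0 := by
  rw [coeff_expand, if_congr Nat.dvd_iff_mod_eq_zero rfl rfl]

theorem five_mul_abar (n : ℕ) :
    5 * abar 5 n = coeff n lambert + 15 * coeff n (X * coreSeries) +
      if n % 2 = 0 then 4 * coeff (n / 2) lambert + 20 * coeff (n / 2) (X * coreSeries) else 0 := by
  have hX : (X : ℤ⟦X⟧) ^ 2 * expand 2 (by norm_num) coreSeries =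
      expand 2 (by norm_num) (X * coreSeries) := by
    rw [map_mul, expand_X]
  have h := congrArg (coeff n) five_mul_abarSeries
  have hc : ∀ (k : ℕ) [k.AtLeastTwo] (f : ℤ⟦X⟧),
      coeff n ((OfNat.ofNat k : ℤ⟦X⟧) * f) = OfNat.ofNat k * coeff n f := fun k _ f => by
    have : (OfNat.ofNat k : ℤ⟦X⟧) = C (OfNat.ofNat k) := (map_ofNat C k).symm
    rw [this, coeff_C_mul]
  rw [hX, map_add, map_add, map_add, hc, hc, hc, hc, abarSeries, coeff_mk, coeff_expand_two,
    coeff_expand_two] at h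
  rw [h]
  split_ifs <;> ring

theorem coeff_succ_X_mul_coreSeries (n : ℕ) : coeff (n + 1) (X * coreSeries) = (c 5 n : ℤ) := by
  rw [coeff_succ_X_mul, coreSeries, coeff_mk]

theorem coeff_five_mul_X_mul_coreSeries (n : ℕ) :
    coeff (5 * n) (X * coreSeries) = 5 * coeff n (X * coreSeries) := by
  have h := congrArg (coeff (5 * n)) (resPart_X_mul_core coreSeries_mul_euler).1
  have h5 : (5 : ℤ⟦X⟧) = C 5 := (map_ofNat C 5).symm
  rw [coeff_resPart, if_pos, h5, coeff_C_mul, coeff_expand_mul] at h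
  · exact h
  · rw [Nat.cast_mul]
    exact zero_mul _

theorem coeff_five_mul_lambert (n : ℕ) : coeff (5 * n) lambert = coeff n lambert := by
  have h := congrArg (coeff (5 * n)) resPart_zero_lambert
  rw [coeff_resPart, if_pos, coeff_expand_mul] at h
  · exact h
  · rw [Nat.cast_mul]
    exact zero_mul _

theorem coeff_lambert_of_ne_zero {n : ℕ} (hn : n ≠ 0) : coeff n lambert = -5 * sigmaChi n := by
  have h5 : (5 : ℤ⟦X⟧) = C 5 := (map_ofNat C 5).symm
  rw [lambert, map_sub, h5, coeff_C_mul, coeff_mk, coeff_one, if_neg hn]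
  ring

theorem coeff_lambert_of_mod_eq {n : ℕ} (h : n % 5 = 1 ∨ n % 5 = 4) :
    coeff n lambert = -5 * coeff n (X * coreSeries) := by
  obtain ⟨-, h1, -, -, h4⟩ := resPart_X_mul_core coreSeries_mul_euler
  have h5 : (-5 : ℤ⟦X⟧) = C (-5) := by simp
  rcases h with h | h
  · have e : (n : ZMod 5) = 1 := (ZMod.natCast_eq_natCast_iff' n 1 5).2 h
    have := congrArg (coeff n) h1
    rwa [h5, coeff_C_mul, coeff_resPart, coeff_resPart, if_pos e, if_pos e] at this
  · have e : (n : ZMod 5) = 4 := (ZMod.natCast_eq_natCast_iff' n 4 5).2 h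
    have := congrArg (coeff n) h4
    rwa [h5, coeff_C_mul, coeff_resPart, coeff_resPart, if_pos e, if_pos e] at this

theorem coeff_lambert_of_mod_eq' {n : ℕ} (h : n % 5 = 2 ∨ n % 5 = 3) :
    coeff n lambert = 5 * coeff n (X * coreSeries) := by
  obtain ⟨-, -, h2, h3, -⟩ := resPart_X_mul_core coreSeries_mul_euler
  have h5 : (5 : ℤ⟦X⟧) = C 5 := (map_ofNat C 5).symm
  rcases h with h | h
  · have e : (n : ZMod 5) = 2 := (ZMod.natCast_eq_natCast_iff' n 2 5).2 h
    have := congrArg (coeff n) h2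
    rwa [h5, coeff_C_mul, coeff_resPart, coeff_resPart, if_pos e, if_pos e] at this
  · have e : (n : ZMod 5) = 3 := (ZMod.natCast_eq_natCast_iff' n 3 5).2 h
    have := congrArg (coeff n) h3
    rwa [h5, coeff_C_mul, coeff_resPart, coeff_resPart, if_pos e, if_pos e] at this

/-- In the even case, `n / 2` lies in the opposite class of residues, so that the terms at `n / 2`
cancel. -/
theorem abar_five_of_mod_five_eq {n : ℕ} (h : n % 5 = 2 ∨ n % 5 = 3) :
    abar 5 n = 4 * coeff n (X * coreSeries) := by
  have h1 := five_mul_abar n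
  rw [coeff_lambert_of_mod_eq' h] at h1
  split_ifs at h1
  · rw [coeff_lambert_of_mod_eq (n := n / 2) (by omega)] at h1
    linarith
  · linarith

theorem abar_five_of_odd {n : ℕ} (h : n % 5 = 1 ∨ n % 5 = 4) (h2 : n % 2 = 1) :
    abar 5 n = 2 * coeff n (X * coreSeries) := by
  have h1 := five_mul_abar n
  rw [coeff_lambert_of_mod_eq h, if_neg (by omega)] at h1
  linarith

/-- The two contributions are comparable because the twisted divisor sum changes sign from `n` to
`2 n` when `n` is odd. -/
theorem abar_five_two_mul {n : ℕ} (h : n % 5 = 2 ∨ n % 5 = 3) (h2 : n % 2 = 1) :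
    abar 5 (2 * n) = 10 * coeff n (X * coreSeries) := by
  have h1 := five_mul_abar (2 * n)
  have h3 := coeff_lambert_of_mod_eq (n := 2 * n) (by omega)
  have h4 := coeff_lambert_of_mod_eq' h
  have h5 := coeff_lambert_of_ne_zero (n := 2 * n) (by omega)
  have h6 := coeff_lambert_of_ne_zero (n := n) (by omega)
  rw [sigmaChi_two_mul h2] at h5
  rw [if_pos (by omega), Nat.mul_div_cancel_left n (by norm_num)] at h1
  linarith

/-- On each progression `5 ^ k n`, the number `5 * abar 5 (5 ^ k * n)` is the sum of a constant and
a multiple of `5 ^ k`. -/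
theorem exists_abar_five_pow_mul (n : ℕ) :
    ∃ x y : ℤ, ∀ k : ℕ, 5 * abar 5 (5 ^ k * n) = x + 5 ^ k * y := by
  refine ⟨coeff n lambert + if n % 2 = 0 then 4 * coeff (n / 2) lambert else 0,
    15 * coeff n (X * coreSeries) +
      if n % 2 = 0 then 20 * coeff (n / 2) (X * coreSeries) else 0, fun k => ?_⟩
  have hl : ∀ (m k : ℕ), coeff (5 ^ k * m) lambert = coeff m lambert := fun m k => by
    induction k with
    | zero => rw [pow_zero, one_mul]
    | succ k ih => rw [pow_succ', mul_assoc, coeff_five_mul_lambert, ih]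
  have hc : ∀ (m k : ℕ), coeff (5 ^ k * m) (X * coreSeries) = 5 ^ k * coeff m (X * coreSeries) :=
    fun m k => by
      induction k with
      | zero => rw [pow_zero, one_mul, pow_zero, one_mul]
      | succ k ih => rw [pow_succ', mul_assoc, coeff_five_mul_X_mul_coreSeries, ih, pow_succ',
          mul_assoc]
  have hpar : 5 ^ k * n % 2 = n % 2 := by rw [Nat.mul_mod, Nat.pow_mod]; simp
  rw [five_mul_abar, hpar, hl, hc]
  split_ifs with h
  · rw [Nat.mul_div_assoc _ (Nat.dvd_of_mod_eq_zero h), hl, hc]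
    ring
  · ring

end CorePartitions

theorem theorem2 :
    (∀ n : ℕ,
      CorePartitions.abar 5 (5 * n + 2) = 4 * (CorePartitions.c 5 (5 * n + 1) : ℤ) ∧
      CorePartitions.abar 5 (5 * n + 3) = 4 * (CorePartitions.c 5 (5 * n + 2) : ℤ) ∧
      CorePartitions.abar 5 (10 * n + 1) = 2 * (CorePartitions.c 5 (10 * n) : ℤ) ∧
      CorePartitions.abar 5 (10 * n + 9) = 2 * (CorePartitions.c 5 (10 * n + 8) : ℤ) ∧
      CorePartitions.abar 5 (20 * n + 6) = 10 * (CorePartitions.c 5 (10 * n + 2) : ℤ) ∧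
      CorePartitions.abar 5 (20 * n + 14) = 10 * (CorePartitions.c 5 (10 * n + 6) : ℤ)) ∧
    (∀ n k : ℕ, 2 ≤ k →
      (CorePartitions.abar 5 (5 ^ k * n) : ℚ) =
        (((5 : ℚ) ^ k - 1) / 4) * (CorePartitions.abar 5 (5 * n) : ℚ) -
          (((5 : ℚ) ^ k - 5) / 4) * (CorePartitions.abar 5 n : ℚ)) := by
  constructor
  · intro n
    refine ⟨?_, ?_, ?_, ?_, ?_, ?_⟩
    · rw [CorePartitions.abar_five_of_mod_five_eq (by omega),
        CorePartitions.coeff_succ_X_mul_coreSeries]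
    · rw [CorePartitions.abar_five_of_mod_five_eq (by omega),
        CorePartitions.coeff_succ_X_mul_coreSeries]
    · rw [CorePartitions.abar_five_of_odd (by omega) (by omega),
        CorePartitions.coeff_succ_X_mul_coreSeries]
    · rw [CorePartitions.abar_five_of_odd (by omega) (by omega),
        CorePartitions.coeff_succ_X_mul_coreSeries]
    · rw [show 20 * n + 6 = 2 * (10 * n + 2 + 1) by ring,
        CorePartitions.abar_five_two_mul (by omega) (by omega),
        CorePartitions.coeff_succ_X_mul_coreSeries]
    · rw [show 20 * n + 14 = 2 * (10 * n + 6 + 1) by ring,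
        CorePartitions.abar_five_two_mul (by omega) (by omega),
        CorePartitions.coeff_succ_X_mul_coreSeries]
  · intro n k _
    obtain ⟨x, y, h⟩ := CorePartitions.exists_abar_five_pow_mul n
    have h0 := congrArg (Int.cast : ℤ → ℚ) (h 0)
    have h1 := congrArg (Int.cast : ℤ → ℚ) (h 1)
    have hk := congrArg (Int.cast : ℤ → ℚ) (h k)
    rw [pow_zero, one_mul] at h0
    rw [pow_one] at h1
    push_cast at h0 h1 hk
    linear_combination hk / 5 - (5 ^ k - 1) / 20 * h1 + (5 ^ k - 5) / 20 * h0
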